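/- All graphs are finite and simple. An acyclic $k$-colouring of a graph $G$ is a proper colouring of $V(G)$ with at most $k$ colours in which any two colour classes together induce a forest (equivalently, no cycle is bicoloured); $\chi_a(G)$ is the least $k$ for which $G$ has an acyclic $k$-colouring. Let $W$ be the Lambert $W$ function, so that $W(1)$ is the unique real $w\ge -1$ with $w e^{w}=1$. For an integer $d\ge 0$ and a family $\mathscr F$ of graphs, let $a(d,\mathscr F)$ be the maximum of $\chi_a(G)$ over all graphs $G$ of maximum degree at most $d$ that contain no member of $\mathscr F$ as a (not necessarily induced) subgraph. Let $C_n$ be the cycle on $n$ vertices. Theorem. (1) There is an absolute constant $C$ such that every graph $G$ of maximum degree $\Delta\ge 1$ and girth at least $7$ (a forest having infinite girth) satisfies \[ \chi_a(G)\;\le\;\frac{\Delta}{W(1)}+C\sqrt{\Delta}\;<\;1.7633\,\Delta+C\sqrt{\Delta}. \] (2) For every sufficiently large integer $d$, the maximum $a(d,\{C_3,C_4,C_6\})$ exists and \[ a(d,\{C_3,C_4,C_6\})<1.7633\,d. \] -/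

import Mathlib

open Filter

/-- The (real, principal branch of the) Lambert `W` function: for `x ≥ -1/e`, the unique
`w ≥ -1` such that `w * exp w = x`. -/
noncomputable def lambertW (x : ℝ) : ℝ :=
  Function.invFunOn (fun w : ℝ => w * Real.exp w) (Set.Ici (-1)) x

/-- On its domain `[-1/e, ∞)`, the function `lambertW` does satisfy its defining equation. -/
theorem lambertW_spec {x : ℝ} (hx : -Real.exp (-1) ≤ x) :
    -1 ≤ lambertW x ∧ lambertW x * Real.exp (lambertW x) = x := by
  have h : ∃ a ∈ Set.Ici (-1 : ℝ), (fun w : ℝ => w * Real.exp w) a = x := by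
    have hc : ContinuousOn (fun w : ℝ => w * Real.exp w) (Set.Icc (-1) |x|) := by fun_prop
    have h1 : (-1 : ℝ) ≤ |x| := by linarith [abs_nonneg x]
    have hm : x ∈ Set.Icc ((-1 : ℝ) * Real.exp (-1)) (|x| * Real.exp |x|) := by
      refine ⟨by linarith, ?_⟩
      have h2 : (1 : ℝ) ≤ Real.exp |x| := Real.one_le_exp (abs_nonneg x)
      nlinarith [abs_nonneg x, le_abs_self x]
    obtain ⟨a, ha, hax⟩ := intermediate_value_Icc h1 hc hm
    exact ⟨a, ha.1, hax⟩
  exact ⟨Function.invFunOn_mem h, Function.invFunOn_eq h⟩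

/-- The defining equation has at most one solution in `[-1, ∞)`. -/
theorem lambertW_unique {w : ℝ} (hw : -1 ≤ w) : lambertW (w * Real.exp w) = w := by
  have hmono : StrictMonoOn (fun w : ℝ => w * Real.exp w) (Set.Ici (-1)) := by
    refine strictMonoOn_of_deriv_pos (convex_Ici _) (by fun_prop) ?_
    intro y hy
    rw [interior_Ici] at hy
    have hd : HasDerivAt (fun w : ℝ => w * Real.exp w) (1 * Real.exp y + y * Real.exp y) y :=
      (hasDerivAt_id y).mul (Real.hasDerivAt_exp y)
    rw [hd.deriv]
    have := Real.exp_pos y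
    have hy' : -1 < y := hy
    nlinarith
  have h : ∃ a ∈ Set.Ici (-1 : ℝ), (fun w : ℝ => w * Real.exp w) a = w * Real.exp w := ⟨w, hw, rfl⟩
  exact hmono.injOn (Function.invFunOn_mem h) hw (Function.invFunOn_eq h)

namespace SimpleGraph

/-- A proper colouring is acyclic if any two colour classes together induce a forest. -/
def Coloring.IsAcyclicColoring {V α : Type*} {G : SimpleGraph V} (c : G.Coloring α) : Prop :=
  ∀ i j : α, (G.induce {v | c v = i ∨ c v = j}).IsAcyclic

/-- The acyclic chromatic number `χ_a(G)` of a finite graph: the least `k` such that `G` has an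
acyclic colouring with (at most) `k` colours. -/
noncomputable def acyclicChromaticNumber {V : Type*} (G : SimpleGraph V) : ℕ :=
  sInf {k : ℕ | ∃ c : G.Coloring (Fin k), c.IsAcyclicColoring}

/-- For a finite graph the minimum in the definition of `χ_a` is over a nonempty set. -/
theorem exists_isAcyclicColoring {V : Type*} [Fintype V] (G : SimpleGraph V) :
    {k : ℕ | ∃ c : G.Coloring (Fin k), c.IsAcyclicColoring}.Nonempty := by
  classical
  let e := Fintype.equivFin V
  refine ⟨Fintype.card V, Coloring.mk e (fun {v w} h => e.injective.ne h.ne), ?_⟩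
  intro i j v p hp
  have h3 := hp.three_le_length
  have hn := hp.support_nodup.length_le_card
  have hl : p.support.tail.length = p.length := by simp
  have hc : Fintype.card {v | e v = i ∨ e v = j} ≤ 2 := by
    have hs : Fintype.card {v | e v = i ∨ e v = j} ≤ Fintype.card ({i, j} : Finset (Fin _)) :=
      Fintype.card_le_of_injective (fun x => ⟨e x.1, by
          rw [Finset.mem_insert, Finset.mem_singleton]; exact x.2⟩)
        (fun x y h => Subtype.ext (e.injective (by simpa using h)))
    refine hs.trans ?_
    rw [Fintype.card_coe]
    exact Finset.card_le_two
  have hn' : p.support.tail.length ≤ Fintype.card {v | e v = i ∨ e v = j} :=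
    hn.trans_eq (Fintype.card_congr (Equiv.refl _))
  omega

open Classical in
/-- The values of `χ_a` on the finite graphs of maximum degree at most `d` that contain no member
of the family `ℱ` as a (not necessarily induced) subgraph. Every finite graph is isomorphic to
one on some `Fin n`. -/
def freeAcyclicChromaticNumbers (d : ℕ) (ℱ : Set (Σ m : ℕ, SimpleGraph (Fin m))) : Set ℕ :=
  {k | ∃ (n : ℕ) (G : SimpleGraph (Fin n)),
    (∀ F ∈ ℱ, F.2.Free G) ∧ G.maxDegree ≤ d ∧ G.acyclicChromaticNumber = k}

/-- `a(d, ℱ)`, the maximum of `χ_a(G)` over all `ℱ`-free graphs `G` of maximum degree at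
most `d` (meaningful when this maximum exists). -/
noncomputable def maxFreeAcyclicChromaticNumber
    (d : ℕ) (ℱ : Set (Σ m : ℕ, SimpleGraph (Fin m))) : ℕ :=
  sSup (freeAcyclicChromaticNumbers d ℱ)

/-- The family `{C₃, C₄, C₆}` of cycle graphs. -/
def cyclesThreeFourSix : Set (Σ m : ℕ, SimpleGraph (Fin m)) :=
  {⟨3, cycleGraph 3⟩, ⟨4, cycleGraph 4⟩, ⟨6, cycleGraph 6⟩}

end SimpleGraph

/-! The proof counts colourings. Let k be the number of colours, D a bound on the degrees, s = √D,
and w = W(1), so that exp(-w) = w. The claim (`growsBelow`) is that if k is at least (D + 8s)/w, and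
at most 10D, then adding a vertex v to a vertex set X multiplies the number of acyclic colourings by
at least β = D + s. In particular the whole graph has one. The induction is on the size of X:
deleting r vertices costs at most a factor β^r, which makes every rare event countable.

A new colour of v must be missed by the neighbours of v. If their colours were independent and
uniform, about k exp(-D/k) colours would be missed, which for k = D/w is wk = D. To get genuine
independence, the acyclic colourings are replaced by those that are locally acyclic at v. Once the
colours off N(v) are fixed, each neighbour then chooses freely from its own list, and a convexity
estimate bounds the average number of missed colours below by wk (`le_sum_card_missedColours`), up
to neighbours with lists shorter than s.

Three losses must be of order s. Short lists are rare, since by induction a vertex has many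
extensions on average (`sum_card_shortListed_le`). A locally acyclic colouring that is not acyclic
has a bicoloured cycle through two neighbours of v, and a colouring of X that v spoils has one
through v; these are rare because a bicoloured path is determined by two of its colours, while
excluding C₃, C₄ and C₆ leaves at most D^m paths of length m + 3 between given ends
(`card_pathsOfLength_le`). As D < β, the resulting geometric series converge. -/

namespace SimpleGraph

/-! ### Paths in graphs without cycles of length 3, 4 or 6 -/

section Paths

variable {V : Type*} {G : SimpleGraph V}

/-- The graph has no cycle of length `3`, `4` or `6`. -/
def NoCyclesThreeFourSix (G : SimpleGraph V) : Prop :=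
  ∀ (a : V) (c : G.Walk a a), c.IsCycle → c.length ≠ 3 ∧ c.length ≠ 4 ∧ c.length ≠ 6

namespace NoCyclesThreeFourSix

theorem no_triangle (hG : G.NoCyclesThreeFourSix) {a b c : V} (hab : G.Adj a b) (hbc : G.Adj b c)
    (hca : G.Adj c a) : False := by
  refine (hG a (.cons hab (.cons hbc (.cons hca .nil))) ?_).1 rfl
  have := hab.ne
  have := hbc.ne
  have := hca.ne
  simp [Walk.cons_isCycle_iff]
  grind

theorem no_square (hG : G.NoCyclesThreeFourSix) {a b c d : V} (hab : G.Adj a b) (hbc : G.Adj b c)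
    (hcd : G.Adj c d) (hda : G.Adj d a) (hac : a ≠ c) (hbd : b ≠ d) : False := by
  refine (hG a (.cons hab (.cons hbc (.cons hcd (.cons hda .nil)))) ?_).2.1 rfl
  have := hab.ne
  have := hbc.ne
  have := hcd.ne
  have := hda.ne
  simp [Walk.cons_isCycle_iff]
  grind

theorem no_hexagon (hG : G.NoCyclesThreeFourSix) {a b c d e f : V} (hab : G.Adj a b)
    (hbc : G.Adj b c) (hcd : G.Adj c d) (hde : G.Adj d e) (hef : G.Adj e f) (hfa : G.Adj f a)
    (hnd : [a, b, c, d, e, f].Nodup) : False := by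
  refine (hG a (.cons hab (.cons hbc (.cons hcd (.cons hde (.cons hef (.cons hfa .nil)))))) ?_).2.2
    rfl
  simp [Walk.cons_isCycle_iff] at hnd ⊢
  grind

/-- Two different paths close up to a hexagon if their inner vertices are all distinct, and
otherwise to a square or a triangle. -/
theorem path_length_three_unique (hG : G.NoCyclesThreeFourSix) {x y : V} {p q : G.Walk x y}
    (hp : p.IsPath) (hq : q.IsPath) (hpl : p.length = 3) (hql : q.length = 3) : p = q := by
  match p, q, hpl, hql with
  | .cons (v := a) h1 (.cons (v := b) h2 (.cons h3 .nil)),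
    .cons (v := a') k1 (.cons (v := b') k2 (.cons k3 .nil)), _, _ =>
    simp at hp hq
    have hsq := @no_square V G hG
    have htr := @no_triangle V G hG
    by_cases ha : a = a'
    · subst ha
      by_cases hb : b = b'
      · subst hb; rfl
      · exact (hsq h2 h3 k3.symm k2.symm (by grind) hb).elim
    · by_cases hb : b = b'
      · subst hb
        exact (hsq h1 h2 k2.symm k1.symm (by grind) ha).elim
      · by_cases h : a = b'
        · subst h; exact (htr h2 h3 k3.symm).elim
        · by_cases h' : b = a'
          · subst h'; exact (htr h1 h2 k1.symm).elim
          · refine (hG.no_hexagon h1 h2 h3 k3.symm k2.symm k1.symm ?_).elim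
            simp
            grind

/-- A shorter walk would form a triangle or a square with `v`. This makes both arcs of a bicoloured
cycle between two neighbours of `v` long enough for the path count. -/
theorem three_le_length_of_adj (hG : G.NoCyclesThreeFourSix) {v u u' : V}
    (hu : G.Adj v u) (hu' : G.Adj v u') (hne : u ≠ u')
    (p : G.Walk u u') (hv : v ∉ p.support) : 3 ≤ p.length := by
  match p, hv with
  | .nil, _ => exact (hne rfl).elim
  | .cons h .nil, _ => exact (hG.no_triangle hu h hu'.symm).elim
  | .cons (v := x) h (.cons h' .nil), hv =>
    refine (hG.no_square hu h h' hu'.symm ?_ hne).elim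
    rintro rfl
    simp at hv
  | .cons h (.cons h' (.cons h'' p)), _ => simp

end NoCyclesThreeFourSix

open Classical in
/-- The finset of paths of length `n` between two vertices. -/
noncomputable def pathsOfLength [Fintype V] (G : SimpleGraph V) (n : ℕ) (u v : V) :
    Finset (G.Walk u v) :=
  {p ∈ G.finsetWalkLength n u v | p.IsPath}

theorem mem_pathsOfLength [Fintype V] {n : ℕ} {u v : V} {p : G.Walk u v} :
    p ∈ G.pathsOfLength n u v ↔ p.length = n ∧ p.IsPath := by
  classical
  rw [pathsOfLength, Finset.mem_filter, mem_finsetWalkLength_iff]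

/-- The first `n` steps have at most `D` choices each; the last three are then forced by uniqueness.
-/
theorem card_pathsOfLength_le [Fintype V] [DecidableRel G.Adj] (hG : G.NoCyclesThreeFourSix) {D : ℕ}
    (hD : ∀ v, G.degree v ≤ D) (n : ℕ) (u v : V) :
    (G.pathsOfLength (n + 3) u v).card ≤ D ^ n := by
  classical
  induction n generalizing u with
  | zero =>
    rw [pow_zero, Finset.card_le_one]
    intro p hp q hq
    rw [mem_pathsOfLength] at hp hq
    exact hG.path_length_three_unique hp.2 hq.2 hp.1 hq.1
  | succ n ih =>
    have hsub : G.pathsOfLength (n + 1 + 3) u v ⊆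
        Finset.univ.biUnion fun w : G.neighborSet u =>
          (G.pathsOfLength (n + 3) w v).image (Walk.cons w.2) := by
      intro p hp
      rw [mem_pathsOfLength] at hp
      match p, hp with
      | .cons (v := w) h p, hp =>
        simp only [Finset.mem_biUnion, Finset.mem_univ, true_and, Finset.mem_image]
        refine ⟨⟨w, h⟩, p, ?_, rfl⟩
        rw [mem_pathsOfLength]
        exact ⟨by simpa using hp.1, hp.2.of_cons⟩
    refine (Finset.card_le_card hsub).trans ?_
    refine (Finset.card_biUnion_le_card_mul _ _ (D ^ n) fun w _ => ?_).trans ?_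
    · exact Finset.card_image_le.trans (ih w)
    rw [pow_succ', Finset.card_univ, card_neighborSet_eq_degree]
    exact Nat.mul_le_mul_right _ (hD u)

end Paths

/-! ### Double counting by resampling some of the values -/

section Resampling

variable {V α : Type*} [DecidableEq V]

/-- The function that is given by `g` on `R` and by `f` outside of `R`. -/
def override (R : Finset V) (f : V → α) (g : R → α) : V → α :=
  fun x => if h : x ∈ R then g ⟨x, h⟩ else f x

theorem override_of_mem {R : Finset V} (f : V → α) (g : R → α) {x : V} (h : x ∈ R) :
    override R f g x = g ⟨x, h⟩ := dif_pos h

theorem override_of_notMem {R : Finset V} (f : V → α) (g : R → α) {x : V} (h : x ∉ R) :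
    override R f g x = f x := dif_neg h

variable [Fintype α]

/-- Summing over all functions is the same as resampling on `R` and averaging. -/
theorem sum_override [Fintype V] (R : Finset V) (φ : (V → α) → ℝ) :
    ∑ f : V → α, ∑ g : R → α, φ (override R f g) =
      (Fintype.card α : ℝ) ^ R.card * ∑ f : V → α, φ f := by
  classical
  -- Exchanging the values of `f` on `R` with the sample `g` is a bijection of the pairs.
  have hinv : Function.Involutive fun q : (V → α) × (R → α) =>
      (override R q.1 q.2, fun x : R => q.1 x) := by
    rintro ⟨f, g⟩
    ext x
    · by_cases h : x ∈ R <;> simp [override, h]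
    · simp [override]
  have h := Equiv.sum_comp hinv.toPerm fun q : (V → α) × (R → α) => φ q.1
  simp only [Function.Involutive.coe_toPerm] at h
  rw [← Fintype.sum_prod_type' (f := fun f g => φ (override R f g)), h, Fintype.sum_prod_type,
    Finset.mul_sum]
  simp

/-- If the members of `A` are determined by their values outside of `R`, and `B` contains all
modifications on `R` of members of `A`, then `B` is larger than `A` by a factor `|α| ^ |R|`. -/
theorem card_mul_pow_le_of_determined {A B : Finset (V → α)} {R : Finset V}
    (hB : ∀ f ∈ A, ∀ f', (∀ x ∉ R, f' x = f x) → f' ∈ B)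
    (hA : ∀ f ∈ A, ∀ f' ∈ A, (∀ x ∉ R, f x = f' x) → f = f') :
    A.card * Fintype.card α ^ R.card ≤ B.card := by
  classical
  have : (A ×ˢ (Finset.univ : Finset (R → α))).card ≤ B.card := by
    refine Finset.card_le_card_of_injOn (fun q => override R q.1 q.2) ?_ ?_
    · rintro ⟨f, g⟩ h
      simp only [Finset.coe_product, Set.mem_prod, Finset.mem_coe] at h
      exact hB f h.1 _ fun x hx => override_of_notMem _ _ hx
    · rintro ⟨f, g⟩ h ⟨f', g'⟩ h' hff
      simp only [Finset.coe_product, Set.mem_prod, Finset.mem_coe] at h h'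
      simp only at hff
      refine Prod.ext (hA f h.1 f' h'.1 fun x hx => ?_) (funext fun x => ?_)
      · simpa [override, hx] using congrFun hff x
      · simpa [override] using congrFun hff x
  simpa using this

/-- Resampling the value at one vertex. -/
theorem card_filter_mem_mul_card [DecidableEq α] {S : Finset (V → α)} {v : V}
    {M : (V → α) → Finset α}
    (hS : ∀ f ∈ S, ∀ x, Function.update f v x ∈ S)
    (hM : ∀ f x, M (Function.update f v x) = M f) :
    {f ∈ S | f v ∈ M f}.card * Fintype.card α = ∑ f ∈ S, (M f).card := by
  have : ({f ∈ S | f v ∈ M f} ×ˢ (Finset.univ : Finset α)).card = (S.sigma M).card := by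
    -- The bijection exchanges the value at `v` with the extra colour; `M` does not see the change.
    refine Finset.card_nbij' (fun q => ⟨Function.update q.1 v q.2, q.1 v⟩)
      (fun q => (Function.update q.1 v q.2, q.1 v)) ?_ ?_ ?_ ?_
    · rintro ⟨f, x⟩ h
      simp at h
      simp [hM, hS f h.1, h.2]
    · rintro ⟨f, x⟩ h
      simp at h
      simp [hM, hS f h.1, h.2]
    · rintro ⟨f, x⟩ h
      simp
    · rintro ⟨f, x⟩ h
      simp
  simpa using this

end Resampling

/-! ### Acyclic colourings of induced subgraphs and bicoloured paths -/

section AcyclicOn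

variable {V α : Type*} {G : SimpleGraph V}

/-- The function `f` is a proper colouring of the subgraph induced by `X`. -/
def ProperOn (G : SimpleGraph V) (f : V → α) (X : Finset V) : Prop :=
  ∀ a ∈ X, ∀ b ∈ X, G.Adj a b → f a ≠ f b

/-- At most two values of `f` occur on `l`. -/
def TwoColoured (f : V → α) (l : List V) : Prop :=
  ∃ i j, ∀ x ∈ l, f x = i ∨ f x = j

/-- The function `f` is an acyclic colouring of the subgraph induced by `X`. -/
def AcyclicOn (G : SimpleGraph V) (f : V → α) (X : Finset V) : Prop :=
  G.ProperOn f X ∧ ∀ (a : V) (c : G.Walk a a), c.IsCycle → (∀ x ∈ c.support, x ∈ X) →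
    ¬ TwoColoured f c.support

theorem ProperOn.mono {f : V → α} {X Y : Finset V} (h : G.ProperOn f X) (hY : Y ⊆ X) :
    G.ProperOn f Y := fun a ha b hb => h a (hY ha) b (hY hb)

theorem TwoColoured.mono {f : V → α} {l l' : List V} (h : TwoColoured f l)
    (hl : ∀ x ∈ l', x ∈ l) : TwoColoured f l' :=
  let ⟨i, j, hij⟩ := h
  ⟨i, j, fun x hx => hij x (hl x hx)⟩

theorem AcyclicOn.mono {f : V → α} {X Y : Finset V} (h : G.AcyclicOn f X) (hY : Y ⊆ X) :
    G.AcyclicOn f Y :=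
  ⟨h.1.mono hY, fun a c hc hs => h.2 a c hc fun x hx => hY (hs x hx)⟩

theorem AcyclicOn.congr {f f' : V → α} {X : Finset V} (h : G.AcyclicOn f X)
    (hf : ∀ x ∈ X, f x = f' x) : G.AcyclicOn f' X := by
  refine ⟨fun a ha b hb hab => ?_, fun a c hc hs ⟨i, j, hij⟩ => h.2 a c hc hs ⟨i, j, ?_⟩⟩
  · rw [← hf a ha, ← hf b hb]
    exact h.1 a ha b hb hab
  · intro x hx
    rw [hf x (hs x hx)]
    exact hij x hx

theorem acyclicOn_congr {f f' : V → α} {X : Finset V} (hf : ∀ x ∈ X, f x = f' x) :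
    G.AcyclicOn f X ↔ G.AcyclicOn f' X :=
  ⟨fun h => h.congr hf, fun h => h.congr fun x hx => (hf x hx).symm⟩

/-- A proper colouring with two given colours alternates along a walk, so its first value fixes all
others. -/
theorem Walk.eq_on_support_of_two_colours {f f' : V → α} {a b : α} {z t : V} (p : G.Walk z t)
    (hf : ∀ x ∈ p.support, f x = a ∨ f x = b) (hf' : ∀ x ∈ p.support, f' x = a ∨ f' x = b)
    (hp : ∀ x ∈ p.support, ∀ y ∈ p.support, G.Adj x y → f x ≠ f y)
    (hp' : ∀ x ∈ p.support, ∀ y ∈ p.support, G.Adj x y → f' x ≠ f' y)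
    (hz : f z = f' z) : ∀ x ∈ p.support, f x = f' x := by
  induction p with
  | nil => simpa using hz
  | @cons u v w h p ih =>
    simp only [support_cons, List.mem_cons, forall_eq_or_imp] at hf hf' hp hp' ⊢
    have hv := p.start_mem_support
    refine ⟨hz, ih hf.2 hf'.2 (fun x hx y hy => (hp.2 x hx).2 y hy)
      (fun x hx y hy => (hp'.2 x hx).2 y hy) ?_⟩
    have h1 := hp.1.2 v hv h
    have h2 := hp'.1.2 v hv h
    have h3 := hf.2 v hv
    have h4 := hf'.2 v hv
    have h5 := hf.1
    grind

theorem Walk.eq_on_support_of_twoColoured [DecidableEq V] {f f' : V → α} {y z t : V}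
    (h : G.Adj y z) (p : G.Walk z t)
    (hf : TwoColoured f (cons h p).support) (hf' : TwoColoured f' (cons h p).support)
    (hp : G.ProperOn f (cons h p).support.toFinset)
    (hp' : G.ProperOn f' (cons h p).support.toFinset)
    (hy : f y = f' y) (hz : f z = f' z) : ∀ x ∈ (cons h p).support, f x = f' x := by
  have hyz : f y ≠ f z := hp y (by simp) z (by simp) h
  have key : ∀ g : V → α, TwoColoured g (cons h p).support → g y = f y → g z = f z →
      ∀ x ∈ (cons h p).support, g x = f y ∨ g x = f z := by
    rintro g ⟨i, j, hij⟩ gy gz x hx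
    have h1 := hij x hx
    have h2 := hij y (by simp)
    have h3 := hij z (by simp)
    grind
  refine (cons h p).eq_on_support_of_two_colours (key f hf rfl rfl) (key f' hf' hy.symm hz.symm)
    (fun x hx y hy => hp x (by simpa using hx) y (by simpa using hy))
    (fun x hx y hy => hp' x (by simpa using hx) y (by simpa using hy)) hy

/-- The colours of `y` and `z` are distinct, hence are the two colours that occur and determine the
rest of the path. Freeing the remaining `p.length` vertices therefore gains a full power of the
number of colours. -/
theorem card_mul_pow_le_of_twoColoured [DecidableEq V] [Fintype α] {y z t : V}
    (h : G.Adj y z) {p : G.Walk z t} (hP : (Walk.cons h p).IsPath) {A B : Finset (V → α)}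
    (hA : ∀ f ∈ A, G.ProperOn f (Walk.cons h p).support.toFinset ∧
      TwoColoured f (Walk.cons h p).support)
    (hB : ∀ f ∈ A, ∀ f', (∀ x ∉ p.support.tail.toFinset, f' x = f x) → f' ∈ B) :
    A.card * Fintype.card α ^ p.length ≤ B.card := by
  have hpath := Walk.cons_isPath_iff h p |>.1 hP
  have hnd : p.support.Nodup := hpath.1.support_nodup
  have hs : p.support = z :: p.support.tail := p.cons_tail_support.symm
  have hcard : p.support.tail.toFinset.card = p.length := by
    rw [List.toFinset_card_of_nodup hnd.tail]
    simp
  rw [← hcard]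
  refine card_mul_pow_le_of_determined hB fun f hf f' hf' heq => ?_
  have hyR : y ∉ p.support.tail.toFinset := fun hy =>
    hpath.2 (List.mem_of_mem_tail (by simpa using hy))
  have hzR : z ∉ p.support.tail.toFinset := fun hz => by
    rw [hs] at hnd
    exact (List.nodup_cons.1 hnd).1 (by simpa using hz)
  have := Walk.eq_on_support_of_twoColoured h p (hA f hf).2 (hA f' hf').2 (hA f hf).1 (hA f' hf').1
    (heq y hyR) (heq z hzR)
  funext x
  by_cases hx : x ∈ p.support.tail.toFinset
  · refine this x ?_
    rw [Walk.support_cons]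
    exact List.mem_cons_of_mem _ (List.mem_of_mem_tail (by simpa using hx))
  · exact heq x hx

/-- On a bicoloured path, the colours of all vertices but two are determined by the others. -/
theorem Walk.IsPath.exists_determined [DecidableEq V] [Fintype α] {y t : V}
    {p : G.Walk y t} (hp : p.IsPath) {r : ℕ} (hr : 0 < r) (hl : p.length = r + 1) :
    ∃ R ⊆ p.support.toFinset, R.card = r ∧ t ∈ R ∧ ∀ A B : Finset (V → α),
      (∀ f ∈ A, G.ProperOn f p.support.toFinset ∧ TwoColoured f p.support) →
      (∀ f ∈ A, ∀ f', (∀ x ∉ R, f' x = f x) → f' ∈ B) → A.card * Fintype.card α ^ r ≤ B.card := by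
  match p, hl with
  | .cons h .nil, hl => simp at hl; omega
  | .cons h (.cons h' p), hl =>
    simp only [Walk.length_cons, add_left_inj] at hl
    have hl' : (Walk.cons h' p).length = r := by simpa using hl
    -- `R` consists of all vertices but the first two, so it contains the endpoint `t`.
    refine ⟨p.support.toFinset, ?_, ?_, by simp, ?_⟩
    · intro x hx
      simp only [List.mem_toFinset] at hx
      simp [hx]
    · rw [List.toFinset_card_of_nodup hp.of_cons.of_cons.support_nodup]
      simpa using hl
    · intro A B hA hB
      rw [← hl']
      exact card_mul_pow_le_of_twoColoured h hp hA hB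

end AcyclicOn

end SimpleGraph

/-! ### Numerical estimates for the exponential and for W(1) -/

theorem exp_neg_le_one_sub {y : ℝ} (h0 : 0 ≤ y) (h1 : y ≤ 1 / 2) :
    Real.exp (-(y + y ^ 2)) ≤ 1 - y := by
  rw [Real.exp_neg]
  refine inv_le_of_inv_le₀ (by linarith) ?_
  have h := Real.quadratic_le_exp_of_nonneg (x := y + y ^ 2) (by positivity)
  refine le_trans ?_ h
  rw [inv_le_iff_one_le_mul₀ (by linarith)]
  have h2 : 0 ≤ y ^ 2 * ((1 - y) * (1 + y) ^ 2 / 2 - y) := by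
    refine mul_nonneg (sq_nonneg y) ?_
    nlinarith [mul_nonneg h0 (sub_nonneg.2 h1), mul_nonneg h0 h0,
      mul_nonneg (mul_nonneg h0 h0) (sub_nonneg.2 h1)]
  nlinarith

theorem lambertW_one_pos : 0 < lambertW 1 := by
  have h := (lambertW_spec (x := 1) (by linarith [Real.exp_pos (-1)])).2
  by_contra! hw
  nlinarith [Real.exp_pos (lambertW 1)]

theorem exp_neg_lambertW_one : Real.exp (-lambertW 1) = lambertW 1 := by
  have h := (lambertW_spec (x := 1) (by linarith [Real.exp_pos (-1)])).2
  rw [Real.exp_neg]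
  exact (eq_inv_of_mul_eq_one_left h).symm

theorem one_div_lambertW_one_lt : 1 / lambertW 1 < 1.7633 := by
  have h := (lambertW_spec (x := 1) (by linarith [Real.exp_pos (-1)])).2
  rw [div_lt_iff₀ lambertW_one_pos]
  by_contra! hw
  have hw' : lambertW 1 ≤ 10000 / 17633 := by linarith
  have h1 : Real.exp (lambertW 1) ≤ Real.exp (10000 / 17633) := Real.exp_le_exp.2 hw'
  -- As `10000 / 17633` is the reciprocal of 1.7633, this makes `w * exp w` less than 1 for every
  -- positive `w` up to it.
  have h2 : Real.exp (10000 / 17633) < 1.7633 := by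
    refine (Real.exp_bound' (n := 8) (by norm_num) (by norm_num) (by norm_num)).trans_lt ?_
    norm_num [Finset.sum_range_succ, Nat.factorial]
  nlinarith [lambertW_one_pos, Real.exp_pos (lambertW 1)]

/-- With y the reciprocal of the list length, 1 - y ≥ exp(-(y + y²)) and y² ≤ y / s. The exponential
form turns a product over lists into a sum in the exponent. -/
theorem card_mul_exp_le_card_erase {α : Type*} [DecidableEq α] {l : Finset α} {s : ℝ} (hs : 2 ≤ s)
    (hl : s ≤ l.card) (x : α) :
    (l.card : ℝ) * Real.exp (-if x ∈ l then (1 + 1 / s) / (l.card : ℝ) else 0) ≤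
      (l.erase x).card := by
  by_cases hx : x ∈ l
  · have hs0 : 0 < s := by linarith
    have hl0 : (0 : ℝ) < l.card := by linarith
    have hy : (1 : ℝ) / l.card ≤ 1 / s := one_div_le_one_div_of_le hs0 hl
    have hy2 : 1 / s ≤ 1 / 2 := one_div_le_one_div_of_le (by norm_num) hs
    have hy0 : (0 : ℝ) ≤ 1 / l.card := by positivity
    have he := exp_neg_le_one_sub hy0 (hy.trans hy2)
    have he2 : Real.exp (-((1 + 1 / s) / (l.card : ℝ))) ≤ 1 - 1 / l.card := by
      refine le_trans (Real.exp_le_exp.2 ?_) he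
      have : (1 + 1 / s) / (l.card : ℝ) = 1 / l.card + 1 / l.card * (1 / s) := by ring
      rw [this]
      nlinarith
    rw [if_pos hx, Finset.card_erase_of_mem hx, Nat.cast_sub (Finset.card_pos.2 ⟨x, hx⟩)]
    calc (l.card : ℝ) * Real.exp (-((1 + 1 / s) / (l.card : ℝ)))
        ≤ l.card * (1 - 1 / l.card) := by gcongr
      _ = l.card - (1 : ℕ) := by field_simp; simp
  · simp [hx]

/-! ### The average number of colours missed by independent choices from lists -/

/-- Exchange the sums: the choices that miss `x` on `A` are the choices from the lists with `x`
erased there. -/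
theorem sum_piFinset_card_missed_eq {ι α : Type*} [Fintype ι] [DecidableEq ι] [Fintype α]
    [DecidableEq α] (L : ι → Finset α) (A : Finset ι) :
    ∑ t ∈ Fintype.piFinset L, ((Finset.univ.filter fun x => ∀ i ∈ A, t i ≠ x).card : ℝ) =
      ∑ x, ∏ i, ((if i ∈ A then (L i).erase x else L i).card : ℝ) := by
  have h2 : ∀ x, ∏ i, ((if i ∈ A then (L i).erase x else L i).card : ℝ) =
      ∑ t ∈ Fintype.piFinset L, if ∀ i ∈ A, t i ≠ x then (1 : ℝ) else 0 := by
    intro x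
    rw [← Nat.cast_prod, ← Fintype.card_piFinset, Finset.sum_boole]
    congr 2
    ext t
    simp only [Fintype.mem_piFinset, Finset.mem_filter, ← forall_and]
    refine forall_congr' fun i => ?_
    by_cases hi : i ∈ A <;> simp [hi, and_comm]
  simp_rw [h2]
  rw [Finset.sum_comm]
  simp

/-- For a random choice from long lists, the average number of missed colours. -/
theorem le_sum_prod_card_erase {ι α : Type*} [Fintype ι] [DecidableEq ι] [Fintype α]
    [DecidableEq α] (L : ι → Finset α) (A : Finset ι) {s w D : ℝ} (hs : 2 ≤ s)
    (hA : ∀ i ∈ A, s ≤ (L i).card) (hw : Real.exp (-w) = w)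
    (hι : (Fintype.card ι : ℝ) ≤ D) (hD : D * (1 + 1 / s) ≤ w * Fintype.card α) :
    w * Fintype.card α * ∏ i, ((L i).card : ℝ) ≤
      ∑ x, ∏ i, ((if i ∈ A then (L i).erase x else L i).card : ℝ) := by
  have hw0 : 0 < w := hw ▸ Real.exp_pos _
  -- The exponent lost by colour `x` in list `i`. Over all colours it sums to at most `1 + 1 / s`,
  -- whatever the list.
  obtain ⟨h, hh⟩ : ∃ h : ι → α → ℝ, ∀ i x, h i x =
    if i ∈ A then (if x ∈ L i then (1 + 1 / s) / ((L i).card : ℝ) else 0) else 0 := ⟨_, fun _ _ => rfl⟩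
  have hs0 : 0 < s := by linarith
  have hfac : ∀ x i, ((L i).card : ℝ) * Real.exp (-h i x) ≤
      ((if i ∈ A then (L i).erase x else L i).card : ℝ) := by
    intro x i
    rw [hh]
    by_cases hi : i ∈ A
    · rw [if_pos hi, if_pos hi]
      exact card_mul_exp_le_card_erase hs (hA i hi) x
    · simp [hi]
  have hprod : ∀ x, (∏ i, ((L i).card : ℝ)) * (w * (1 + w - ∑ i, h i x)) ≤
      ∏ i, ((if i ∈ A then (L i).erase x else L i).card : ℝ) := by
    intro x
    refine le_trans ?_ (Finset.prod_le_prod (fun i _ => by positivity) fun i _ => hfac x i)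
    rw [Finset.prod_mul_distrib, ← Real.exp_sum, Finset.sum_neg_distrib]
    refine mul_le_mul_of_nonneg_left ?_ (Finset.prod_nonneg fun i _ => Nat.cast_nonneg _)
    -- Tangent line of exp(-H) at H = w, where its value is w. It is linear in H, so only the
    -- average of H over the colours matters, and `hD` makes that at most w.
    have h3 := Real.add_one_le_exp (w - ∑ i, h i x)
    calc w * (1 + w - ∑ i, h i x) ≤ w * Real.exp (w - ∑ i, h i x) :=
          mul_le_mul_of_nonneg_left (by linarith) hw0.le
      _ = Real.exp (-w) * Real.exp (w - ∑ i, h i x) := by rw [hw]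
      _ = Real.exp (-∑ i, h i x) := by rw [← Real.exp_add]; congr 1; ring
  refine le_trans ?_ (Finset.sum_le_sum fun x _ => hprod x)
  have hsum : ∑ x, ∑ i, h i x ≤ w * Fintype.card α := by
    rw [Finset.sum_comm]
    have h4 : ∀ i, ∑ x, h i x ≤ 1 + 1 / s := by
      intro i
      simp only [hh]
      by_cases hi : i ∈ A
      · have hl0 : ((L i).card : ℝ) ≠ 0 := by linarith [hA i hi]
        simp only [hi, if_true]
        rw [Finset.sum_ite_mem, Finset.univ_inter, Finset.sum_const, nsmul_eq_mul,
          mul_div_cancel₀ _ hl0]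
      · simp only [hi, if_false, Finset.sum_const_zero]
        positivity
    refine (Finset.sum_le_card_nsmul _ _ _ fun i _ => h4 i).trans ?_
    rw [nsmul_eq_mul, Finset.card_univ]
    exact (mul_le_mul_of_nonneg_right hι (by positivity)).trans hD
  rw [← Finset.mul_sum, mul_comm, ← Finset.mul_sum]
  refine mul_le_mul_of_nonneg_left ?_ (Finset.prod_nonneg fun i _ => Nat.cast_nonneg _)
  refine mul_le_mul_of_nonneg_left ?_ hw0.le
  rw [Finset.sum_sub_distrib, Finset.sum_const, nsmul_eq_mul, Finset.card_univ]
  linarith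

/-- For a random choice from lists, the average number of missed colours, with short lists
compensated for. -/
theorem le_sum_piFinset_card_missed {ι α : Type*} [Fintype ι] [DecidableEq ι] [Fintype α]
    [DecidableEq α] (L : ι → Finset α) {s w D : ℝ} (hs : 2 ≤ s) (hw : Real.exp (-w) = w)
    (hι : (Fintype.card ι : ℝ) ≤ D) (hD : D * (1 + 1 / s) ≤ w * Fintype.card α) :
    w * Fintype.card α * ∏ i, ((L i).card : ℝ) ≤
      ∑ t ∈ Fintype.piFinset L, (((Finset.univ.filter fun x => ∀ i, t i ≠ x).card : ℝ) +
        (Finset.univ.filter fun i => ((L i).card : ℝ) < s).card) := by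
  have h1 : ∀ t : ι → α,
      ((Finset.univ.filter fun x => ∀ i ∈ Finset.univ.filter fun i => s ≤ ((L i).card : ℝ),
        t i ≠ x).card : ℝ) ≤
      (Finset.univ.filter fun x => ∀ i, t i ≠ x).card +
        (Finset.univ.filter fun i => ((L i).card : ℝ) < s).card := by
    intro t
    -- A colour missed by the long lists but used somewhere is the choice of a short list, so each
    -- short list costs at most one colour.
    have hsub : (Finset.univ.filter fun x => ∀ i ∈ Finset.univ.filter fun i =>
          s ≤ ((L i).card : ℝ), t i ≠ x) ⊆
        (Finset.univ.filter fun x => ∀ i, t i ≠ x) ∪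
          (Finset.univ.filter fun i => ((L i).card : ℝ) < s).image t := by
      intro x hx
      simp only [Finset.mem_union, Finset.mem_filter, Finset.mem_univ, true_and,
        Finset.mem_image] at hx ⊢
      by_cases h : ∀ i, t i ≠ x
      · exact .inl h
      · push Not at h
        obtain ⟨i, hi⟩ := h
        exact .inr ⟨i, not_le.1 fun hl => hx i hl hi, hi⟩
    exact_mod_cast (Finset.card_le_card hsub).trans ((Finset.card_union_le _ _).trans
      (Nat.add_le_add_left Finset.card_image_le _))
  refine le_trans ?_ (Finset.sum_le_sum fun t _ => h1 t)
  rw [sum_piFinset_card_missed_eq]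
  exact le_sum_prod_card_erase L _ hs (by simp) hw hι hD

namespace SimpleGraph

/-! ### Local acyclicity at a vertex and the bicoloured cycles it leaves -/

section Structure

variable {V α : Type*} [Fintype V] [DecidableEq V] {G : SimpleGraph V} [DecidableRel G.Adj]

/-- The function `f` is an acyclic colouring of all subgraphs that are induced by at most one
neighbour of `v` in `X` and the non-neighbours of `v` in `X`. -/
def LocallyAcyclicOn (G : SimpleGraph V) [DecidableRel G.Adj] (v : V) (f : V → α)
    (X : Finset V) : Prop :=
  G.AcyclicOn f (X \ G.neighborFinset v) ∧
    ∀ u ∈ X ∩ G.neighborFinset v, G.AcyclicOn f (insert u (X \ G.neighborFinset v))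

theorem AcyclicOn.locallyAcyclicOn {f : V → α} {X : Finset V} (h : G.AcyclicOn f X) (v : V) :
    G.LocallyAcyclicOn v f X :=
  ⟨h.mono Finset.sdiff_subset, fun _ hu => h.mono
    (Finset.insert_subset (Finset.mem_of_mem_inter_left hu) Finset.sdiff_subset)⟩

theorem LocallyAcyclicOn.mono {v : V} {f : V → α} {X Y : Finset V}
    (h : G.LocallyAcyclicOn v f X) (hY : Y ⊆ X) : G.LocallyAcyclicOn v f Y :=
  ⟨h.1.mono (Finset.sdiff_subset_sdiff hY le_rfl), fun u hu =>
    (h.2 u (Finset.inter_subset_inter_right hY hu)).mono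
      (Finset.insert_subset_insert _ (Finset.sdiff_subset_sdiff hY le_rfl))⟩

theorem LocallyAcyclicOn.congr {v : V} {f f' : V → α} {X : Finset V}
    (h : G.LocallyAcyclicOn v f X) (hf : ∀ x ∈ X, f x = f' x) : G.LocallyAcyclicOn v f' X :=
  ⟨h.1.congr fun x hx => hf x (Finset.sdiff_subset hx), fun u hu => (h.2 u hu).congr fun x hx => by
    rcases Finset.mem_insert.1 hx with rfl | hx
    · exact hf _ (Finset.mem_of_mem_inter_left hu)
    · exact hf x (Finset.sdiff_subset hx)⟩

/-- Neighbours of `v` are pairwise non-adjacent, for want of triangles, so each edge within `X` lies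
in one of the sets controlled by the hypothesis. -/
theorem LocallyAcyclicOn.properOn (hG : G.NoCyclesThreeFourSix) {v : V} {f : V → α} {X : Finset V}
    (h : G.LocallyAcyclicOn v f X) : G.ProperOn f X := by
  intro a ha b hb hab
  by_cases haN : a ∈ G.neighborFinset v
  · by_cases hbN : b ∈ G.neighborFinset v
    · rw [mem_neighborFinset] at haN hbN
      exact (hG.no_triangle haN hab hbN.symm).elim
    · exact (h.2 a (by simp [ha, haN, -mem_neighborFinset])).1 a (by simp) b
        (by simp [hb, hbN, -mem_neighborFinset]) hab
  · by_cases hbN : b ∈ G.neighborFinset v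
    · exact (h.2 b (by simp [hb, hbN, -mem_neighborFinset])).1 a
        (by simp [ha, haN, -mem_neighborFinset]) b (by simp) hab
    · exact h.1.1 a (by simp [ha, haN, -mem_neighborFinset]) b
        (by simp [hb, hbN, -mem_neighborFinset]) hab

/-- A new bicoloured cycle through `v` gives a bicoloured path from a neighbour of `v` to `v`. -/
theorem exists_path_of_not_acyclicOn_insert (hG : G.NoCyclesThreeFourSix) {v : V} {f : V → α}
    {X : Finset V} (hf : G.AcyclicOn f X) (hp : G.ProperOn f (insert v X))
    (hn : ¬ G.AcyclicOn f (insert v X)) :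
    ∃ w ∈ G.neighborFinset v, ∃ m < Fintype.card V, ∃ p ∈ G.pathsOfLength (m + 3) w v,
      (∀ x ∈ p.support, x ∈ insert v X) ∧ TwoColoured f p.support := by
  obtain ⟨a, c, hc, hcX, hc2⟩ : ∃ (a : V) (c : G.Walk a a), c.IsCycle ∧
      (∀ x ∈ c.support, x ∈ insert v X) ∧ TwoColoured f c.support := by
    by_contra! hcon
    exact hn ⟨hp, hcon⟩
  have hv : v ∈ c.support := by
    by_contra hv
    refine hf.2 a c hc (fun x hx => ?_) hc2
    exact (Finset.mem_insert.1 (hcX x hx)).resolve_left (by rintro rfl; exact hv hx)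
  have hc' := hc.rotate hv
  have hs := fun x => (c.mem_support_rotate_iff (w := x) v hv).1
  generalize c.rotate v hv = c' at hc' hs
  cases c' with
  | nil => exact (hc'.not_nil .nil).elim
  | @cons _ w _ h p =>
    have hlen := hc'.three_le_length
    have h3 := (hG _ _ hc').1
    have hpath := (Walk.cons_isCycle_iff p h).1 hc' |>.1
    have hlt := hpath.length_lt
    simp only [Walk.length_cons] at hlen h3
    have hs' : ∀ x ∈ p.support, x ∈ c.support := fun x hx => hs x (by simp [hx])
    refine ⟨w, by simpa using h, p.length - 3, by omega, p, ?_, fun x hx => hcX x (hs' x hx),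
      hc2.mono hs'⟩
    exact mem_pathsOfLength.2 ⟨by omega, hpath⟩

/-- A bicoloured cycle of a locally acyclic colouring goes through two neighbours of `v`. -/
theorem LocallyAcyclicOn.exists_paths (hG : G.NoCyclesThreeFourSix) {v : V} {f : V → α}
    {X : Finset V} (hf : G.LocallyAcyclicOn v f X) (hv : v ∉ X) (hn : ¬ G.AcyclicOn f X) :
    ∃ u ∈ G.neighborFinset v, ∃ u' ∈ G.neighborFinset v, ∃ m < Fintype.card V,
      ∃ n < Fintype.card V, ∃ p ∈ G.pathsOfLength (m + 3) u u',
      ∃ q ∈ G.pathsOfLength (n + 3) u' u, (p.append q).IsCycle ∧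
      (∀ x ∈ (p.append q).support, x ∈ X) ∧ TwoColoured f (p.append q).support := by
  obtain ⟨a, c, hc, hcX, hc2⟩ : ∃ (a : V) (c : G.Walk a a), c.IsCycle ∧
      (∀ x ∈ c.support, x ∈ X) ∧ TwoColoured f c.support := by
    by_contra! hcon
    exact hn ⟨hf.properOn hG, hcon⟩
  -- A cycle with at most one vertex in N(v) lies in a set on which `f` is acyclic by assumption.
  obtain ⟨u, huc, huN⟩ : ∃ u ∈ c.support, u ∈ G.neighborFinset v := by
    by_contra! hcon
    exact hf.1.2 a c hc (fun x hx => Finset.mem_sdiff.2 ⟨hcX x hx, hcon x hx⟩) hc2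
  obtain ⟨u', huc', huN', hne⟩ : ∃ u' ∈ c.support, u' ∈ G.neighborFinset v ∧ u ≠ u' := by
    by_contra! hcon
    refine (hf.2 u (Finset.mem_inter.2 ⟨hcX u huc, huN⟩)).2 a c hc (fun x hx => ?_) hc2
    rw [Finset.mem_insert, Finset.mem_sdiff]
    by_cases hx' : x ∈ G.neighborFinset v
    · exact .inl (hcon x hx hx').symm
    · exact .inr ⟨hcX x hx, hx'⟩
  have hc' := hc.rotate huc
  have hs := fun x => (c.mem_support_rotate_iff (w := x) u huc)
  generalize c.rotate u huc = c' at hc' hs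
  have hu' : u' ∈ c'.support := (hs u').2 huc'
  have hspec := c'.take_spec hu'
  have hp := hc'.isPath_takeUntil hu'
  generalize c'.takeUntil u' hu' = p at hspec hp
  generalize c'.dropUntil u' hu' = q at hspec
  subst hspec
  have hq : q.IsPath := by
    cases p with
    | nil => exact (hne rfl).elim
    | cons h p =>
      rw [Walk.cons_append, Walk.cons_isCycle_iff] at hc'
      exact hc'.1.of_append_right
  have hsX : ∀ x ∈ (p.append q).support, x ∈ X := fun x hx => hcX x ((hs x).1 hx)
  have hvp : v ∉ p.support := fun h => hv (hsX v (by simp [Walk.mem_support_append_iff, h]))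
  have hvq : v ∉ q.support := fun h => hv (hsX v (by simp [Walk.mem_support_append_iff, h]))
  -- Both arcs avoid `v` because `v ∉ X`.
  have hp3 := hG.three_le_length_of_adj (by simpa using huN) (by simpa using huN') hne p hvp
  have hq3 := hG.three_le_length_of_adj (by simpa using huN') (by simpa using huN) hne.symm q hvq
  have hpl := hp.length_lt
  have hql := hq.length_lt
  exact ⟨u, huN, u', huN', p.length - 3, by omega, q.length - 3, by omega, p,
    mem_pathsOfLength.2 ⟨by omega, hp⟩, q, mem_pathsOfLength.2 ⟨by omega, hq⟩, hc', hsX,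
    hc2.mono fun x hx => (hs x).1 hx⟩

end Structure

/-! ### The growth hypothesis, and locally acyclic colourings that are not acyclic -/

section Counting

variable {V α : Type*} [Fintype V] [DecidableEq V] [Fintype α] {G : SimpleGraph V}

open Classical in
/-- The functions that are acyclic colourings on `X`; their values outside of `X` are arbitrary. -/
noncomputable def acyclicFunctions (G : SimpleGraph V) (α : Type*) [Fintype α] (X : Finset V) :
    Finset (V → α) :=
  {f | G.AcyclicOn f X}

theorem mem_acyclicFunctions {f : V → α} {X : Finset V} :
    f ∈ G.acyclicFunctions α X ↔ G.AcyclicOn f X := by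
  simp [acyclicFunctions]

open Classical in
/-- The functions that are locally acyclic around `v` on `X`. -/
noncomputable def locallyAcyclicFunctions (G : SimpleGraph V) [DecidableRel G.Adj] (α : Type*)
    [Fintype α] (v : V) (X : Finset V) : Finset (V → α) :=
  {f | G.LocallyAcyclicOn v f X}

theorem mem_locallyAcyclicFunctions [DecidableRel G.Adj] {v : V} {f : V → α} {X : Finset V} :
    f ∈ G.locallyAcyclicFunctions α v X ↔ G.LocallyAcyclicOn v f X := by
  simp [locallyAcyclicFunctions]

theorem acyclicFunctions_subset_locallyAcyclicFunctions [DecidableRel G.Adj] (v : V)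
    (X : Finset V) : G.acyclicFunctions α X ⊆ G.locallyAcyclicFunctions α v X := fun f hf => by
  rw [mem_acyclicFunctions] at hf
  exact mem_locallyAcyclicFunctions.2 (hf.locallyAcyclicOn v)

/-- For all vertex sets of size less than `n`, adding a vertex multiplies the number of acyclic
colourings by at least `β`. -/
def GrowsBelow (G : SimpleGraph V) (α : Type*) [Fintype α] (β : ℝ) (n : ℕ) : Prop :=
  ∀ Y : Finset V, Y.card < n → ∀ v ∉ Y,
    β * (G.acyclicFunctions α Y).card ≤ Fintype.card α * (G.acyclicFunctions α (insert v Y)).card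

/-- Add the vertices of `X \ Y` one at a time. The power of the number of colours appears because
functions are defined on all of `V` and are free outside the set. -/
theorem GrowsBelow.pow_mul_card_le {β : ℝ} (hβ : 0 ≤ β) {n : ℕ} (h : G.GrowsBelow α β n)
    {r : ℕ} {X Y : Finset V} (hYX : Y ⊆ X) (hX : X.card ≤ n) (hr : (X \ Y).card = r) :
    β ^ r * (G.acyclicFunctions α Y).card ≤
      (Fintype.card α : ℝ) ^ r * (G.acyclicFunctions α X).card := by
  induction r generalizing Y with
  | zero =>
    rw [Finset.card_eq_zero, Finset.sdiff_eq_empty_iff_subset] at hr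
    rw [hYX.antisymm hr]
    simp
  | succ r ih =>
    obtain ⟨v, hv⟩ : (X \ Y).Nonempty := Finset.card_pos.1 (by omega)
    rw [Finset.mem_sdiff] at hv
    have hc : Y.card < n := by
      have := Finset.card_sdiff_add_card_eq_card hYX
      omega
    have h1 := h Y hc v hv.2
    have h2 := ih (Y := insert v Y) (Finset.insert_subset hv.1 hYX) (by
      rw [Finset.sdiff_insert, Finset.card_erase_of_mem (Finset.mem_sdiff.2 hv), hr]; simp)
    calc β ^ (r + 1) * ((G.acyclicFunctions α Y).card : ℝ)
        = β ^ r * (β * (G.acyclicFunctions α Y).card) := by ring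
      _ ≤ β ^ r * (Fintype.card α * (G.acyclicFunctions α (insert v Y)).card) := by gcongr
      _ = Fintype.card α * (β ^ r * (G.acyclicFunctions α (insert v Y)).card) := by ring
      _ ≤ Fintype.card α * ((Fintype.card α : ℝ) ^ r * (G.acyclicFunctions α X).card) := by gcongr
      _ = _ := by ring

theorem card_biUnion_le_sum_real {ι κ : Type*} [DecidableEq κ] {s : Finset ι} {t : ι → Finset κ}
    {b : ι → ℝ} (h : ∀ i ∈ s, ((t i).card : ℝ) ≤ b i) : ((s.biUnion t).card : ℝ) ≤ ∑ i ∈ s, b i :=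
  le_trans (by exact_mod_cast Finset.card_biUnion_le) (Finset.sum_le_sum h)

theorem sum_geometric_ratio_le {x y : ℝ} (hx : 0 ≤ x) (hxy : x < y) (n : ℕ) :
    ∑ m ∈ Finset.range n, x ^ m / y ^ m ≤ y / (y - x) := by
  have hy : 0 < y := by linarith
  have hr : x / y < 1 := (div_lt_one hy).2 hxy
  simp_rw [← div_pow]
  refine (Summable.sum_le_tsum _ (fun i _ => by positivity)
    (summable_geometric_of_lt_one (by positivity) hr)).trans ?_
  rw [tsum_geometric_of_lt_one (by positivity) hr]
  rw [← one_div, div_le_div_iff₀ (by linarith) (by linarith)]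
  have : y * (1 - x / y) = y - x := by field_simp
  linarith

variable [DecidableRel G.Adj]

open Classical in
-- The cycle has m + n + 6 vertices. Dropping an edge leaves a bicoloured path, on which all but two
-- colours are determined. Freeing those m + n + 4 vertices gives a smaller set, where `hloc`
-- compares with acyclic colourings and `hgrow` leads back to `X`.
theorem card_locallyAcyclic_twoColoured_cycle_le {β ε : ℝ} (hβ : 0 < β) (hα : 0 < Fintype.card α)
    (hG : G.NoCyclesThreeFourSix) {X : Finset V} (hgrow : G.GrowsBelow α β X.card) {v : V}
    (hloc : ∀ Y : Finset V, Y.card < X.card → v ∉ Y →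
      ((G.locallyAcyclicFunctions α v Y).card : ℝ) ≤ (1 + ε) * (G.acyclicFunctions α Y).card)
    (hε : 0 ≤ ε) (hv : v ∉ X) {u u' : V} {m n : ℕ} {p : G.Walk u u'} (hp : p.length = m + 3)
    {q : G.Walk u' u} (hq : q.length = n + 3) :
    (((G.locallyAcyclicFunctions α v X).filter fun f => (p.append q).IsCycle ∧
      (∀ x ∈ (p.append q).support, x ∈ X) ∧ TwoColoured f (p.append q).support).card : ℝ) ≤
      (1 + ε) * (G.acyclicFunctions α X).card / β ^ (m + n + 4) := by
  by_cases hc : (p.append q).IsCycle ∧ ∀ x ∈ (p.append q).support, x ∈ X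
  swap
  · rw [Finset.filter_eq_empty_iff.2 fun f _ h => hc ⟨h.1, h.2.1⟩]
    simp only [Finset.card_empty, Nat.cast_zero]
    positivity
  have hlen : (p.append q).length = m + n + 6 := by rw [Walk.length_append]; omega
  generalize p.append q = c at hc hlen
  obtain ⟨hc, hcX⟩ := hc
  cases c with
  | nil => simp at hlen
  | cons h P =>
    simp only [Walk.length_cons] at hlen
    have hP : P.IsPath := ((Walk.cons_isCycle_iff P h).1 hc).1
    obtain ⟨R, hR, hRc, -, hdet⟩ := hP.exists_determined (α := α) (r := m + n + 4) (by omega)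
      (by omega)
    have hPX : P.support.toFinset ⊆ X := fun x hx => hcX x (by simp at hx; simp [hx])
    have hRX := hR.trans hPX
    have hXR : X \ (X \ R) = R := Finset.sdiff_sdiff_eq_self hRX
    have hlt : (X \ R).card < X.card := by
      have := Finset.card_sdiff_add_card_eq_card hRX
      omega
    have h1 := hdet ((G.locallyAcyclicFunctions α v X).filter fun f => (Walk.cons h P).IsCycle ∧
      (∀ x ∈ (Walk.cons h P).support, x ∈ X) ∧ TwoColoured f (Walk.cons h P).support)
      (G.locallyAcyclicFunctions α v (X \ R)) (by
        intro f hf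
        rw [Finset.mem_filter, mem_locallyAcyclicFunctions] at hf
        exact ⟨(hf.1.properOn hG).mono hPX, hf.2.2.2.mono fun x hx => by simp [hx]⟩) (by
        intro f hf f' hff
        rw [Finset.mem_filter, mem_locallyAcyclicFunctions] at hf
        exact mem_locallyAcyclicFunctions.2 ((hf.1.mono Finset.sdiff_subset).congr
          fun x hx => (hff x (Finset.mem_sdiff.1 hx).2).symm))
    have h2 := hloc (X \ R) hlt (fun h => hv (Finset.sdiff_subset h))
    have h3 := hgrow.pow_mul_card_le hβ.le (r := m + n + 4) (Finset.sdiff_subset (s := X) (t := R))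
      le_rfl (by rw [hXR, hRc])
    have h1' : (((G.locallyAcyclicFunctions α v X).filter fun f => (Walk.cons h P).IsCycle ∧
      (∀ x ∈ (Walk.cons h P).support, x ∈ X) ∧ TwoColoured f (Walk.cons h P).support).card : ℝ) *
      (Fintype.card α : ℝ) ^ (m + n + 4) ≤ (G.locallyAcyclicFunctions α v (X \ R)).card := by
      exact_mod_cast h1
    have hk : (0 : ℝ) < (Fintype.card α : ℝ) ^ (m + n + 4) := by positivity
    rw [le_div_iff₀ (by positivity)]
    refine le_of_mul_le_mul_right ?_ hk
    calc _ = (_ * (Fintype.card α : ℝ) ^ (m + n + 4)) * β ^ (m + n + 4) := by ring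
      _ ≤ ((1 + ε) * (G.acyclicFunctions α (X \ R)).card) * β ^ (m + n + 4) :=
        mul_le_mul_of_nonneg_right (h1'.trans h2) (by positivity)
      _ = (1 + ε) * (β ^ (m + n + 4) * (G.acyclicFunctions α (X \ R)).card) := by ring
      _ ≤ (1 + ε) * ((Fintype.card α : ℝ) ^ (m + n + 4) * (G.acyclicFunctions α X).card) := by
        gcongr
      _ = _ := by ring

open Classical in
/-- Most locally acyclic colourings are acyclic. -/
theorem card_locallyAcyclicFunctions_sdiff_le {β ε : ℝ} {D : ℕ} (hD : ∀ v, G.degree v ≤ D)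
    (hDβ : D < β) (hα : 0 < Fintype.card α)
    (hG : G.NoCyclesThreeFourSix) {X : Finset V} (hgrow : G.GrowsBelow α β X.card) {v : V}
    (hloc : ∀ Y : Finset V, Y.card < X.card → v ∉ Y →
      ((G.locallyAcyclicFunctions α v Y).card : ℝ) ≤ (1 + ε) * (G.acyclicFunctions α Y).card)
    (hε : 0 ≤ ε) (hv : v ∉ X) :
    ((G.locallyAcyclicFunctions α v X \ G.acyclicFunctions α X).card : ℝ) ≤
      (D / (β * (β - D))) ^ 2 * (1 + ε) * (G.acyclicFunctions α X).card := by
  have hβ : 0 < β := lt_of_le_of_lt (Nat.cast_nonneg D) hDβ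
  have hsub : G.locallyAcyclicFunctions α v X \ G.acyclicFunctions α X ⊆
      (G.neighborFinset v).biUnion fun u => (G.neighborFinset v).biUnion fun u' =>
      (Finset.range (Fintype.card V)).biUnion fun m =>
      (Finset.range (Fintype.card V)).biUnion fun n =>
      (G.pathsOfLength (m + 3) u u').biUnion fun p => (G.pathsOfLength (n + 3) u' u).biUnion fun q =>
      (G.locallyAcyclicFunctions α v X).filter fun f => (p.append q).IsCycle ∧
        (∀ x ∈ (p.append q).support, x ∈ X) ∧ TwoColoured f (p.append q).support := by
    intro f hf
    rw [Finset.mem_sdiff, mem_acyclicFunctions, mem_locallyAcyclicFunctions] at hf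
    obtain ⟨u, hu, u', hu', m, hm, n, hn, p, hp, q, hq, h⟩ := hf.1.exists_paths hG hv hf.2
    simp only [Finset.mem_biUnion, Finset.mem_range, Finset.mem_filter]
    exact ⟨u, hu, u', hu', m, hm, n, hn, p, hp, q, hq, mem_locallyAcyclicFunctions.2 hf.1, h⟩
  have hN : (0 : ℝ) ≤ (1 + ε) * (G.acyclicFunctions α X).card := by positivity
  set N : ℝ := (1 + ε) * (G.acyclicFunctions α X).card with hNdef
  have hpaths : ∀ (m : ℕ) (a b : V), ((G.pathsOfLength (m + 3) a b).card : ℝ) ≤ (D : ℝ) ^ m :=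
    fun m a b => by exact_mod_cast card_pathsOfLength_le hG hD m a b
  have hdeg : ((G.neighborFinset v).card : ℝ) ≤ D := by exact_mod_cast hD v
  refine (Nat.cast_le.2 (Finset.card_le_card hsub)).trans ?_
  have hpq : ∀ (u u' : V) (m n : ℕ),
      (((G.pathsOfLength (m + 3) u u').biUnion fun p => (G.pathsOfLength (n + 3) u' u).biUnion
        fun q => (G.locallyAcyclicFunctions α v X).filter fun f => (p.append q).IsCycle ∧
        (∀ x ∈ (p.append q).support, x ∈ X) ∧ TwoColoured f (p.append q).support).card : ℝ) ≤
      (D : ℝ) ^ m / β ^ m * ((D : ℝ) ^ n / β ^ n) * (N / β ^ 4) := by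
    intro u u' m n
    refine (card_biUnion_le_sum_real fun p hp => card_biUnion_le_sum_real fun q hq =>
      card_locallyAcyclic_twoColoured_cycle_le hβ hα hG hgrow hloc hε hv
        (mem_pathsOfLength.1 hp).1 (mem_pathsOfLength.1 hq).1).trans ?_
    rw [Finset.sum_const, Finset.sum_const, nsmul_eq_mul, nsmul_eq_mul, ← hNdef]
    calc _ ≤ (D : ℝ) ^ m * ((D : ℝ) ^ n * (N / β ^ (m + n + 4))) := by
          gcongr
          · exact hpaths m u u'
          · exact hpaths n u' u
      _ = _ := by
        field_simp
        ring
  refine (card_biUnion_le_sum_real fun u _ => card_biUnion_le_sum_real fun u' _ =>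
    card_biUnion_le_sum_real fun m _ => card_biUnion_le_sum_real fun n _ => hpq u u' m n).trans ?_
  have hgeo := sum_geometric_ratio_le (Nat.cast_nonneg D) hDβ (Fintype.card V)
  have hgeo0 : 0 ≤ ∑ m ∈ Finset.range (Fintype.card V), (D : ℝ) ^ m / β ^ m :=
    Finset.sum_nonneg fun m _ => by positivity
  rw [Finset.sum_const, Finset.sum_const, nsmul_eq_mul, nsmul_eq_mul]
  simp_rw [← Finset.sum_mul]
  rw [← Finset.sum_mul_sum]
  have hs : 0 < β - D := by linarith
  -- One factor `D` for each of the two neighbours of `v`, and one geometric series for each arc.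
  calc _ ≤ (D : ℝ) * (D * ((β / (β - D)) * (β / (β - D)) * (N / β ^ 4))) := by
        gcongr
    _ = _ := by
      rw [mul_assoc (_ ^ 2), ← hNdef]
      field_simp

end Counting

/-! ### Adding the vertex: spoiled colourings, lists and missed colours -/

section Extension

variable {V α : Type*} [Fintype V] [DecidableEq V] [Fintype α] {G : SimpleGraph V}

open Classical in
-- Of the m + 4 vertices of the path all but two are determined, one of these being `v`. As `v ∉ X`,
-- its value is unconstrained on the right and contributes the exact factor `Fintype.card α`; each
-- of the other m + 1 contributes `β`.
theorem card_acyclic_twoColoured_path_le {β : ℝ} (hβ : 0 < β) (hα : 0 < Fintype.card α)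
    {X : Finset V} (hgrow : G.GrowsBelow α β X.card) {v w : V} (hv : v ∉ X) {m : ℕ}
    {p : G.Walk w v} (hp : p.IsPath) (hl : p.length = m + 3) :
    (((G.acyclicFunctions α X).filter fun f => G.ProperOn f (insert v X) ∧
      (∀ x ∈ p.support, x ∈ insert v X) ∧ TwoColoured f p.support).card : ℝ) ≤
      (G.acyclicFunctions α X).card / (Fintype.card α * β ^ (m + 1)) := by
  by_cases hpX : ∀ x ∈ p.support, x ∈ insert v X
  swap
  · rw [Finset.filter_eq_empty_iff.2 fun f _ h => hpX h.2.1]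
    simp only [Finset.card_empty, Nat.cast_zero]
    positivity
  obtain ⟨R, hR, hRc, hvR, hdet⟩ := hp.exists_determined (α := α) (r := m + 2) (by omega) hl
  have hpX' : p.support.toFinset ⊆ insert v X := fun x hx => hpX x (by simpa using hx)
  have hRX := hR.trans hpX'
  have hXR : X \ (X \ R) = R.erase v := by
    ext x
    have := @hRX x
    simp only [Finset.mem_insert] at this
    simp only [Finset.mem_sdiff, Finset.mem_erase]
    constructor
    · rintro ⟨h1, h2⟩
      exact ⟨by rintro rfl; exact hv h1, by tauto⟩
    · rintro ⟨h1, h2⟩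
      have := this h2
      tauto
  have h1 := hdet ((G.acyclicFunctions α X).filter fun f => G.ProperOn f (insert v X) ∧
      (∀ x ∈ p.support, x ∈ insert v X) ∧ TwoColoured f p.support)
    (G.acyclicFunctions α (X \ R)) (by
      intro f hf
      rw [Finset.mem_filter] at hf
      exact ⟨hf.2.1.mono hpX', hf.2.2.2⟩) (by
      intro f hf f' hff
      rw [Finset.mem_filter, mem_acyclicFunctions] at hf
      exact mem_acyclicFunctions.2 ((hf.1.mono Finset.sdiff_subset).congr
        fun x hx => (hff x (Finset.mem_sdiff.1 hx).2).symm))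
  have h3 := hgrow.pow_mul_card_le hβ.le (r := m + 1) (Finset.sdiff_subset (s := X) (t := R))
    le_rfl (by rw [hXR, Finset.card_erase_of_mem hvR, hRc]; rfl)
  have h1' : (((G.acyclicFunctions α X).filter fun f => G.ProperOn f (insert v X) ∧
      (∀ x ∈ p.support, x ∈ insert v X) ∧ TwoColoured f p.support).card : ℝ) *
      (Fintype.card α : ℝ) ^ (m + 2) ≤ (G.acyclicFunctions α (X \ R)).card := by
    exact_mod_cast h1
  have hk : (0 : ℝ) < (Fintype.card α : ℝ) ^ (m + 1) := by positivity
  rw [le_div_iff₀ (by positivity)]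
  refine le_of_mul_le_mul_right ?_ hk
  calc _ = β ^ (m + 1) * (_ * (Fintype.card α : ℝ) ^ (m + 2)) := by ring
    _ ≤ β ^ (m + 1) * (G.acyclicFunctions α (X \ R)).card :=
      mul_le_mul_of_nonneg_left h1' (by positivity)
    _ ≤ (Fintype.card α : ℝ) ^ (m + 1) * (G.acyclicFunctions α X).card := h3
    _ = _ := by ring

variable [DecidableRel G.Adj]

open Classical in
/-- Few acyclic colourings become bicoloured on a cycle when `v` is added. -/
theorem card_proper_not_acyclic_le {β : ℝ} {D : ℕ} (hD : ∀ v, G.degree v ≤ D)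
    (hDβ : D < β) (hα : 0 < Fintype.card α) (hG : G.NoCyclesThreeFourSix) {X : Finset V}
    (hgrow : G.GrowsBelow α β X.card) {v : V} (hv : v ∉ X) :
    (((G.acyclicFunctions α X).filter fun f => G.ProperOn f (insert v X) ∧
      ¬ G.AcyclicOn f (insert v X)).card : ℝ) * Fintype.card α ≤
      D / (β - D) * (G.acyclicFunctions α X).card := by
  have hβ : 0 < β := lt_of_le_of_lt (Nat.cast_nonneg D) hDβ
  have hsub : ((G.acyclicFunctions α X).filter fun f => G.ProperOn f (insert v X) ∧
      ¬ G.AcyclicOn f (insert v X)) ⊆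
      (G.neighborFinset v).biUnion fun w => (Finset.range (Fintype.card V)).biUnion fun m =>
      (G.pathsOfLength (m + 3) w v).biUnion fun p =>
      (G.acyclicFunctions α X).filter fun f => G.ProperOn f (insert v X) ∧
      (∀ x ∈ p.support, x ∈ insert v X) ∧ TwoColoured f p.support := by
    intro f hf
    rw [Finset.mem_filter, mem_acyclicFunctions] at hf
    obtain ⟨w, hw, m, hm, p, hp, h⟩ :=
      exists_path_of_not_acyclicOn_insert hG hf.1 hf.2.1 hf.2.2
    simp only [Finset.mem_biUnion, Finset.mem_range, Finset.mem_filter]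
    exact ⟨w, hw, m, hm, p, hp, mem_acyclicFunctions.2 hf.1, hf.2.1, h⟩
  set N : ℝ := ((G.acyclicFunctions α X).card : ℝ) with hNdef
  have hk : (0 : ℝ) < Fintype.card α := by exact_mod_cast hα
  have hN : 0 ≤ N := Nat.cast_nonneg _
  rw [← le_div_iff₀ hk]
  refine (Nat.cast_le.2 (Finset.card_le_card hsub)).trans ?_
  have hpm : ∀ (w : V) (m : ℕ), (((G.pathsOfLength (m + 3) w v).biUnion fun p =>
      (G.acyclicFunctions α X).filter fun f => G.ProperOn f (insert v X) ∧
      (∀ x ∈ p.support, x ∈ insert v X) ∧ TwoColoured f p.support).card : ℝ) ≤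
      (D : ℝ) ^ m / β ^ m * (N / (Fintype.card α * β)) := by
    intro w m
    refine (card_biUnion_le_sum_real fun p hp => card_acyclic_twoColoured_path_le hβ hα hgrow hv
      (mem_pathsOfLength.1 hp).2 (mem_pathsOfLength.1 hp).1).trans ?_
    rw [Finset.sum_const, nsmul_eq_mul, ← hNdef]
    have hpaths : ((G.pathsOfLength (m + 3) w v).card : ℝ) ≤ (D : ℝ) ^ m := by
      exact_mod_cast card_pathsOfLength_le hG hD m w v
    calc _ ≤ (D : ℝ) ^ m * (N / (Fintype.card α * β ^ (m + 1))) := by gcongr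
      _ = _ := by
        field_simp
        ring
  refine (card_biUnion_le_sum_real fun w _ => card_biUnion_le_sum_real fun m _ =>
    hpm w m).trans ?_
  have hgeo := sum_geometric_ratio_le (Nat.cast_nonneg D) hDβ (Fintype.card V)
  have hdeg : ((G.neighborFinset v).card : ℝ) ≤ D := by exact_mod_cast hD v
  rw [Finset.sum_const, nsmul_eq_mul, ← Finset.sum_mul]
  have hs : 0 < β - D := by linarith
  calc _ ≤ (D : ℝ) * ((β / (β - D)) * (N / (Fintype.card α * β))) := by gcongr
    _ = _ := by field_simp

open Classical in
/-- The colours that extend `f` to `u` acyclically on the non-neighbours of `v` in `X`. -/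
noncomputable def extensionList (G : SimpleGraph V) [DecidableRel G.Adj] (v : V) (X : Finset V)
    (f : V → α) (u : V) : Finset α :=
  {x | G.AcyclicOn (Function.update f u x) (insert u (X \ G.neighborFinset v))}

theorem mem_extensionList {v : V} {X : Finset V} {f : V → α} {u : V} {x : α} :
    x ∈ G.extensionList v X f u ↔
      G.AcyclicOn (Function.update f u x) (insert u (X \ G.neighborFinset v)) := by
  simp [extensionList]

theorem extensionList_congr {v : V} {X : Finset V} {f f' : V → α} {u : V}
    (h : ∀ x ∈ X \ G.neighborFinset v, x ≠ u → f x = f' x) :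
    G.extensionList v X f u = G.extensionList v X f' u := by
  ext c
  rw [mem_extensionList, mem_extensionList]
  refine acyclicOn_congr fun x hx => ?_
  by_cases hxu : x = u
  · subst hxu; simp
  · simp only [Function.update_of_ne hxu]
    exact h x ((Finset.mem_insert.1 hx).resolve_left hxu) hxu

variable [DecidableEq α]

/-- The colours missed by `f` on the neighbours of `v` in `X`. -/
def missedColours (G : SimpleGraph V) [DecidableRel G.Adj] (v : V) (X : Finset V)
    (f : V → α) : Finset α :=
  {x | ∀ u ∈ X ∩ G.neighborFinset v, f u ≠ x}

/-- The neighbours of `v` in `X` with fewer than `s` possible colours. -/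
noncomputable def shortListed (G : SimpleGraph V) [DecidableRel G.Adj] (v : V) (X : Finset V)
    (s : ℝ) (f : V → α) : Finset V :=
  {u ∈ X ∩ G.neighborFinset v | ((G.extensionList v X f u).card : ℝ) < s}

/-- Given the colours off N(v), local acyclicity says exactly that each neighbour in `X` takes a
colour from its extension list. Resampling the neighbours thus gives independent uniform choices
from lists, to which the list estimate applies. -/
theorem le_sum_card_missedColours {s w : ℝ} {D : ℕ} (hD : ∀ v, G.degree v ≤ D) (hs : 2 ≤ s)
    (hw : Real.exp (-w) = w) (hk : D * (1 + 1 / s) ≤ w * Fintype.card α)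
    (hα : 0 < Fintype.card α) (v : V) (X : Finset V) :
    w * Fintype.card α * (G.locallyAcyclicFunctions α v X).card ≤
      ∑ f ∈ G.locallyAcyclicFunctions α v X,
        (((G.missedColours v X f).card : ℝ) + (G.shortListed v X s f).card) := by
  classical
  set R := X ∩ G.neighborFinset v with hR
  have hnotR : ∀ x ∈ X \ G.neighborFinset v, x ∉ R := fun x hx hx' =>
    (Finset.mem_sdiff.1 hx).2 (Finset.mem_of_mem_inter_right hx')
  have hov : ∀ (f : V → α) (g : R → α), G.LocallyAcyclicOn v (override R f g) X ↔
      G.AcyclicOn f (X \ G.neighborFinset v) ∧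
        g ∈ Fintype.piFinset fun u : R => G.extensionList v X f u := by
    intro f g
    refine and_congr (acyclicOn_congr fun x hx => override_of_notMem f g (hnotR x hx)) ?_
    simp only [Fintype.mem_piFinset, mem_extensionList, Subtype.forall]
    refine forall_congr' fun u => forall_congr' fun hu => acyclicOn_congr fun x hx => ?_
    by_cases hxu : x = u
    · subst hxu
      simp [override_of_mem f g hu]
    · rw [Function.update_of_ne hxu]
      exact override_of_notMem f g (hnotR x ((Finset.mem_insert.1 hx).resolve_left hxu))
  have hmiss : ∀ (f : V → α) (g : R → α), G.missedColours v X (override R f g) =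
      Finset.univ.filter fun x => ∀ i, g i ≠ x := by
    intro f g
    ext x
    simp only [missedColours, ← hR, Finset.mem_filter, Finset.mem_univ, true_and, Subtype.forall]
    refine forall_congr' fun u => forall_congr' fun hu => ?_
    rw [override_of_mem f g hu]
  have hshort : ∀ (f : V → α) (g : R → α), (G.shortListed v X s (override R f g)).card =
      (Finset.univ.filter fun u : R => ((G.extensionList v X f u).card : ℝ) < s).card := by
    intro f g
    have hext : ∀ u, G.extensionList v X (override R f g) u = G.extensionList v X f u := fun u =>
      extensionList_congr fun x hx _ => override_of_notMem f g (hnotR x hx)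
    rw [shortListed, ← hR]
    simp_rw [hext]
    rw [← Finset.card_map (Function.Embedding.subtype _)]
    congr 1
    ext u
    simp [and_comm]
  have hcardR : (Fintype.card R : ℝ) ≤ D := by
    rw [Fintype.card_coe]
    exact_mod_cast (Finset.card_le_card Finset.inter_subset_right).trans (hD v)
  -- For each fixed `f` the inner sum is already nonnegative, by the list estimate.
  have key : 0 ≤ ∑ f : V → α, ∑ g : R → α,
      (if G.LocallyAcyclicOn v (override R f g) X then
        ((G.missedColours v X (override R f g)).card : ℝ) +
          (G.shortListed v X s (override R f g)).card - w * Fintype.card α else 0) := by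
    refine Finset.sum_nonneg fun f _ => ?_
    simp_rw [hov, hmiss, hshort]
    by_cases hf : G.AcyclicOn f (X \ G.neighborFinset v)
    · simp only [hf, true_and]
      rw [← Finset.sum_filter, Finset.filter_univ_mem, Finset.sum_sub_distrib, sub_nonneg]
      refine le_trans (le_of_eq ?_)
        (le_sum_piFinset_card_missed (fun u : R => G.extensionList v X f u) hs hw hcardR hk)
      rw [Finset.sum_const, nsmul_eq_mul, Fintype.card_piFinset, Nat.cast_prod, mul_comm]
    · simp [hf]
  rw [sum_override R fun f => if G.LocallyAcyclicOn v f X then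
        ((G.missedColours v X f).card : ℝ) + (G.shortListed v X s f).card - w * Fintype.card α
        else 0] at key
  have hk0 : (0 : ℝ) < (Fintype.card α : ℝ) ^ R.card := by positivity
  have key' := nonneg_of_mul_nonneg_right key hk0
  rw [← Finset.sum_filter, Finset.sum_sub_distrib, sub_nonneg, Finset.sum_const, nsmul_eq_mul] at key'
  have hfil : Finset.univ.filter (fun f : V → α => G.LocallyAcyclicOn v f X) =
      G.locallyAcyclicFunctions α v X := by
    ext f
    simp [mem_locallyAcyclicFunctions]
  rw [hfil] at key'
  linarith

/-- Delete a neighbour `u`. A colouring of the rest with a short list at `u` extends in at most `s`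
ways, whereas by `hgrow` the average acyclic colouring extends in at least `β` ways. So `u` is
short-listed in a proportion of about `s / β`, and there are at most `D < β` neighbours. -/
theorem sum_card_shortListed_le {s β ε : ℝ} {D : ℕ} (hD : ∀ v, G.degree v ≤ D)
    (hDβ : D < β) (hα : 0 < Fintype.card α) (hs : 0 ≤ s) (hε : 0 ≤ ε)
    {X : Finset V} (hgrow : G.GrowsBelow α β X.card) {v : V}
    (hloc : ∀ Y : Finset V, Y.card < X.card → v ∉ Y →
      ((G.locallyAcyclicFunctions α v Y).card : ℝ) ≤ (1 + ε) * (G.acyclicFunctions α Y).card)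
    (hv : v ∉ X) :
    ∑ f ∈ G.locallyAcyclicFunctions α v X, ((G.shortListed v X s f).card : ℝ) ≤
      s * (1 + ε) * (G.acyclicFunctions α X).card := by
  classical
  have hβ : 0 < β := lt_of_le_of_lt (Nat.cast_nonneg D) hDβ
  have hk : (0 : ℝ) < Fintype.card α := by exact_mod_cast hα
  set N : ℝ := ((G.acyclicFunctions α X).card : ℝ) with hN
  have hN0 : 0 ≤ N := Nat.cast_nonneg _
  have hu : ∀ u ∈ X ∩ G.neighborFinset v, (((G.locallyAcyclicFunctions α v X).filter fun f =>
      ((G.extensionList v X f u).card : ℝ) < s).card : ℝ) ≤ s * (1 + ε) * N / β := by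
    intro u hu
    have huX := Finset.mem_of_mem_inter_left hu
    have huN := Finset.mem_of_mem_inter_right hu
    have hupd : ∀ (f : V → α) x, G.extensionList v X (Function.update f u x) u =
        G.extensionList v X f u := fun f x =>
      extensionList_congr fun y _ hy => Function.update_of_ne hy _ _
    set S := (G.locallyAcyclicFunctions α v (X.erase u)).filter fun f =>
      ((G.extensionList v X f u).card : ℝ) < s with hS
    -- Neither condition defining `S` depends on the colour of `u`, so that colour can be resampled.
    have hSinv : ∀ f ∈ S, ∀ x, Function.update f u x ∈ S := by
      intro f hf x
      rw [hS, Finset.mem_filter, mem_locallyAcyclicFunctions] at hf ⊢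
      refine ⟨hf.1.congr fun y hy => (Function.update_of_ne (Finset.ne_of_mem_erase hy) _ _).symm, ?_⟩
      rw [hupd]
      exact hf.2
    have hsub : ((G.locallyAcyclicFunctions α v X).filter fun f =>
        ((G.extensionList v X f u).card : ℝ) < s) ⊆ {f ∈ S | f u ∈ G.extensionList v X f u} := by
      intro f hf
      rw [Finset.mem_filter, mem_locallyAcyclicFunctions] at hf
      rw [Finset.mem_filter, hS, Finset.mem_filter, mem_locallyAcyclicFunctions, mem_extensionList,
        Function.update_eq_self]
      exact ⟨⟨hf.1.mono (Finset.erase_subset _ _), hf.2⟩, hf.1.2 u hu⟩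
    have h1 := card_filter_mem_mul_card (M := fun f => G.extensionList v X f u) hSinv
      (fun f x => hupd f x)
    have h2 : ((∑ f ∈ S, (G.extensionList v X f u).card : ℕ) : ℝ) ≤ S.card * s := by
      rw [Nat.cast_sum, ← nsmul_eq_mul]
      refine Finset.sum_le_card_nsmul _ _ _ fun f hf => ?_
      rw [hS, Finset.mem_filter] at hf
      exact hf.2.le
    have hlt : (X.erase u).card < X.card := Finset.card_erase_lt_of_mem huX
    have h3 : (S.card : ℝ) ≤ (1 + ε) * (G.acyclicFunctions α (X.erase u)).card :=
      (Nat.cast_le.2 (Finset.card_filter_le _ _)).trans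
        (hloc _ hlt fun h => hv (Finset.mem_of_mem_erase h))
    have h4 := hgrow (X.erase u) hlt u (Finset.notMem_erase _ _)
    rw [Finset.insert_erase huX] at h4
    rw [← h1, Nat.cast_mul] at h2
    have h5 : (((G.locallyAcyclicFunctions α v X).filter fun f =>
      ((G.extensionList v X f u).card : ℝ) < s).card : ℝ) ≤
      ({f ∈ S | f u ∈ G.extensionList v X f u}.card : ℝ) :=
      Nat.cast_le.2 (Finset.card_le_card hsub)
    rw [le_div_iff₀ hβ]
    refine le_of_mul_le_mul_right ?_ hk
    calc _ ≤ ({f ∈ S | f u ∈ G.extensionList v X f u}.card : ℝ) * β * Fintype.card α := by gcongr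
      _ = ({f ∈ S | f u ∈ G.extensionList v X f u}.card : ℝ) * Fintype.card α * β := by ring
      _ ≤ (S.card * s) * β := by gcongr
      _ ≤ ((1 + ε) * (G.acyclicFunctions α (X.erase u)).card * s) * β := by gcongr
      _ = s * (1 + ε) * (β * (G.acyclicFunctions α (X.erase u)).card) := by ring
      _ ≤ s * (1 + ε) * (Fintype.card α * N) := by gcongr
      _ = _ := by ring
  have hswap : ∑ f ∈ G.locallyAcyclicFunctions α v X, ((G.shortListed v X s f).card : ℝ) =
      ∑ u ∈ X ∩ G.neighborFinset v, (((G.locallyAcyclicFunctions α v X).filter fun f =>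
      ((G.extensionList v X f u).card : ℝ) < s).card : ℝ) := by
    simp_rw [shortListed, Finset.card_filter, Nat.cast_sum]
    exact Finset.sum_comm
  rw [hswap]
  refine (Finset.sum_le_card_nsmul _ _ _ hu).trans ?_
  rw [nsmul_eq_mul]
  have hc : ((X ∩ G.neighborFinset v).card : ℝ) ≤ β :=
    le_trans (by exact_mod_cast (Finset.card_le_card Finset.inter_subset_right).trans (hD v)) hDβ.le
  calc _ ≤ β * (s * (1 + ε) * N / β) := by gcongr
    _ = _ := by field_simp

end Extension

/-! ### The induction -/

section Main

variable {V α : Type*} [Fintype V] [DecidableEq V] [Fintype α] {G : SimpleGraph V}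
  [DecidableRel G.Adj]

/-- Giving `v` a missed colour yields a proper colouring, which is either acyclic or has a
bicoloured cycle through `v`; the second kind is the error term. -/
theorem sum_card_missedColours_le [DecidableEq α] {β : ℝ} {D : ℕ} (hD : ∀ v, G.degree v ≤ D)
    (hDβ : D < β) (hα : 0 < Fintype.card α) (hG : G.NoCyclesThreeFourSix) {X : Finset V}
    (hgrow : G.GrowsBelow α β X.card) {v : V} (hv : v ∉ X) :
    ∑ f ∈ G.acyclicFunctions α X, ((G.missedColours v X f).card : ℝ) ≤
      Fintype.card α * (G.acyclicFunctions α (insert v X)).card +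
        D / (β - D) * (G.acyclicFunctions α X).card := by
  classical
  have hne : ∀ x ∈ X, x ≠ v := by
    rintro x hx rfl
    exact hv hx
  have h1 := card_filter_mem_mul_card (S := G.acyclicFunctions α X) (v := v)
    (M := G.missedColours v X)
    (fun f hf x => mem_acyclicFunctions.2 ((mem_acyclicFunctions.1 hf).congr fun y hy =>
      (Function.update_of_ne (hne y hy) _ _).symm))
    (fun f x => by
      ext c
      simp only [missedColours, Finset.mem_filter, Finset.mem_univ, true_and]
      refine forall_congr' fun u => forall_congr' fun hu => ?_
      rw [Function.update_of_ne (hne u (Finset.mem_of_mem_inter_left hu))])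
  have hsub : {f ∈ G.acyclicFunctions α X | f v ∈ G.missedColours v X f} ⊆
      G.acyclicFunctions α (insert v X) ∪
      (G.acyclicFunctions α X).filter fun f => G.ProperOn f (insert v X) ∧
      ¬ G.AcyclicOn f (insert v X) := by
    intro f hf
    rw [Finset.mem_filter] at hf
    rw [Finset.mem_union, Finset.mem_filter, mem_acyclicFunctions (X := insert v X)]
    have hprop := (mem_acyclicFunctions.1 hf.1).1
    have hmiss : ∀ u ∈ X, G.Adj v u → f u ≠ f v := fun u hu hvu => by
      have := hf.2
      simp only [missedColours, Finset.mem_filter, Finset.mem_univ, true_and] at this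
      exact this u (by simp [hu, hvu])
    have hp : G.ProperOn f (insert v X) := by
      intro a ha b hb hab
      rcases Finset.mem_insert.1 ha with rfl | ha'
      · rcases Finset.mem_insert.1 hb with rfl | hb'
        · exact (hab.ne rfl).elim
        · exact (hmiss b hb' hab).symm
      · rcases Finset.mem_insert.1 hb with rfl | hb'
        · exact hmiss a ha' hab.symm
        · exact hprop a ha' b hb' hab
    by_cases h : G.AcyclicOn f (insert v X)
    · exact .inl h
    · exact .inr ⟨hf.1, hp, h⟩
  have h2 : ({f ∈ G.acyclicFunctions α X | f v ∈ G.missedColours v X f}.card : ℝ) ≤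
      (G.acyclicFunctions α (insert v X)).card +
      ((G.acyclicFunctions α X).filter fun f => G.ProperOn f (insert v X) ∧
      ¬ G.AcyclicOn f (insert v X)).card := by
    exact_mod_cast (Finset.card_le_card hsub).trans (Finset.card_union_le _ _)
  have h3 := card_proper_not_acyclic_le hD hDβ hα hG hgrow hv
  rw [← Nat.cast_sum, ← h1, Nat.cast_mul]
  calc _ ≤ ((G.acyclicFunctions α (insert v X)).card +
      (((G.acyclicFunctions α X).filter fun f => G.ProperOn f (insert v X) ∧
      ¬ G.AcyclicOn f (insert v X)).card : ℝ)) * Fintype.card α := by gcongr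
    _ ≤ _ := by linarith

/-- Adding a vertex multiplies the number of acyclic colourings by at least `D + √D`. -/
theorem growsBelow {D : ℕ} (hD : ∀ v, G.degree v ≤ D) (hG : G.NoCyclesThreeFourSix) {w : ℝ}
    (hw : Real.exp (-w) = w) (hD100 : 100 ≤ D) (hk : D + 8 * √(D : ℝ) ≤ w * Fintype.card α)
    (hk' : (Fintype.card α : ℝ) ≤ 10 * D) (n : ℕ) : G.GrowsBelow α (D + √(D : ℝ)) n := by
  classical
  obtain ⟨s, hs⟩ : ∃ s, s = √(D : ℝ) := ⟨_, rfl⟩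
  rw [← hs] at hk ⊢
  have hss : (D : ℝ) = s ^ 2 := by rw [hs, Real.sq_sqrt (Nat.cast_nonneg D)]
  have hD' : (100 : ℝ) ≤ D := by exact_mod_cast hD100
  have hs10 : 10 ≤ s := by
    rw [hs]
    exact Real.le_sqrt_of_sq_le (by linarith)
  have hs0 : 0 < s := by linarith
  have hα : 0 < Fintype.card α := by
    by_contra h
    have : Fintype.card α = 0 := by omega
    rw [this, Nat.cast_zero, mul_zero] at hk
    linarith
  have hk0 : (0 : ℝ) < Fintype.card α := by exact_mod_cast hα
  have hw0 : 0 < w := hw ▸ Real.exp_pos _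
  have hDβ : (D : ℝ) < D + s := by linarith
  have hβD : (D : ℝ) + s - D = s := by ring
  -- For β = D + s the proportion of bad locally acyclic colourings is at most (1 + ε)/(s + 1)²,
  -- which is below 2/D; so ε = 2/D reproduces itself in the induction.
  obtain ⟨ε, hε⟩ : ∃ ε : ℝ, ε = 2 / D := ⟨_, rfl⟩
  have hεD : ε * D = 2 := by rw [hε]; exact div_mul_cancel₀ _ (by linarith)
  have hε0 : 0 ≤ ε := by rw [hε]; positivity
  have hε1 : ε ≤ 1 := by nlinarith
  -- Both estimates are proved together, since each uses the other on smaller sets.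
  have key : ∀ m, ∀ X : Finset V, X.card = m → ∀ v ∉ X,
      ((G.locallyAcyclicFunctions α v X).card : ℝ) ≤ (1 + ε) * (G.acyclicFunctions α X).card ∧
      (D + s) * (G.acyclicFunctions α X).card ≤
        Fintype.card α * (G.acyclicFunctions α (insert v X)).card := by
    intro m
    induction m using Nat.strong_induction_on with
    | _ m ih =>
      intro X hX v hv
      subst hX
      have hgrow : G.GrowsBelow α (D + s) X.card := fun Y hY u hu => (ih _ hY Y rfl u hu).2
      have hloc : ∀ Y : Finset V, Y.card < X.card → v ∉ Y →
          ((G.locallyAcyclicFunctions α v Y).card : ℝ) ≤ (1 + ε) * (G.acyclicFunctions α Y).card :=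
        fun Y hY hvY => (ih _ hY Y rfl v hvY).1
      have hsub := acyclicFunctions_subset_locallyAcyclicFunctions (G := G) (α := α) v X
      obtain ⟨S, hS⟩ : ∃ S : ℝ, S = (G.acyclicFunctions α X).card := ⟨_, rfl⟩
      have hS0 : 0 ≤ S := by rw [hS]; exact Nat.cast_nonneg _
      have hdiff := card_locallyAcyclicFunctions_sdiff_le hD hDβ hα hG hgrow hloc hε0 hv
      have hTS : ((G.locallyAcyclicFunctions α v X).card : ℝ) =
          S + (G.locallyAcyclicFunctions α v X \ G.acyclicFunctions α X).card := by
        rw [hS]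
        exact_mod_cast (Finset.card_sdiff_add_card_eq_card hsub).symm.trans (add_comm _ _)
      have hdiffε : ((G.locallyAcyclicFunctions α v X \ G.acyclicFunctions α X).card : ℝ) ≤
          ε * S := by
        refine hdiff.trans ?_
        rw [hβD, ← hS]
        refine mul_le_mul_of_nonneg_right ?_ hS0
        have h1 : (D : ℝ) / ((D + s) * s) = 1 / (s + 1) := by
          rw [hss]
          field_simp
        rw [h1, hε, hss]
        have h2 : (1 / (s + 1)) ^ 2 ≤ 1 / s ^ 2 := by
          rw [div_pow, one_pow]
          exact one_div_le_one_div_of_le (by positivity) (by nlinarith)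
        have h3 : 1 + 2 / s ^ 2 ≤ 2 := by
          rw [← hss, ← hε]
          linarith
        calc _ ≤ 1 / s ^ 2 * 2 := by gcongr
          _ = _ := by ring
      refine ⟨by rw [hTS, ← hS]; linarith, ?_⟩
      have hmiss := sum_card_missedColours_le hD hDβ hα hG hgrow hv
      rw [hβD, ← hS] at hmiss
      have hDs : (D : ℝ) / s = s := by rw [hss]; field_simp
      rw [hDs] at hmiss
      have hshort := sum_card_shortListed_le hD hDβ hα hs0.le hε0 hgrow hloc hv
      rw [← hS] at hshort
      have hsum := le_sum_card_missedColours (s := s) hD (by linarith) hw (by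
        have : (D : ℝ) * (1 + 1 / s) = D + s := by rw [mul_add, mul_one, mul_one_div, hDs]
        rw [this]
        linarith) hα v X
      rw [Finset.sum_add_distrib, ← Finset.sum_sdiff hsub] at hsum
      have hout : ∑ f ∈ G.locallyAcyclicFunctions α v X \ G.acyclicFunctions α X,
          ((G.missedColours v X f).card : ℝ) ≤ ε * S * Fintype.card α := by
        refine (Finset.sum_le_card_nsmul _ _ (Fintype.card α : ℝ) fun f _ => ?_).trans ?_
        · exact_mod_cast Finset.card_le_univ _
        · rw [nsmul_eq_mul]
          gcongr
      have hT : S ≤ (G.locallyAcyclicFunctions α v X).card := by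
        rw [hTS]
        exact le_add_of_nonneg_right (Nat.cast_nonneg _)
      have hwk : (D + 8 * s) * S ≤ w * Fintype.card α * (G.locallyAcyclicFunctions α v X).card := by
        gcongr
      have hεk : ε * S * Fintype.card α ≤ 20 * S := by
        calc _ ≤ ε * S * (10 * D) := by gcongr
          _ = 10 * (ε * D) * S := by ring
          _ = _ := by rw [hεD]; ring
      have hse : s * (1 + ε) * S ≤ 2 * s * S := by
        refine mul_le_mul_of_nonneg_right ?_ hS0
        nlinarith
      have h20 : 20 * S ≤ 2 * s * S := mul_le_mul_of_nonneg_right (by linarith) hS0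
      have hsS : 0 ≤ s * S := by positivity
      rw [← hS]
      -- From (D + 8s)S are subtracted sS for cycles through `v`, at most 2sS for short lists, and
      -- at most 20S ≤ 2sS for colourings that are only locally acyclic. More than (D + s)S remains
      -- when S > 0.
      linarith
  exact fun Y _ v hv => (key _ Y rfl v hv).2

/-- Apply the growth estimate from the empty set, on which every function is acyclic. -/
theorem exists_acyclicOn_univ {D : ℕ} (hD : ∀ v, G.degree v ≤ D) (hG : G.NoCyclesThreeFourSix)
    {w : ℝ} (hw : Real.exp (-w) = w) (hD100 : 100 ≤ D)
    (hk : D + 8 * √(D : ℝ) ≤ w * Fintype.card α) (hk' : (Fintype.card α : ℝ) ≤ 10 * D) :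
    ∃ f : V → α, G.AcyclicOn f Finset.univ := by
  have hD' : (100 : ℝ) ≤ D := by exact_mod_cast hD100
  have hα : Nonempty α := by
    by_contra h
    rw [not_nonempty_iff] at h
    simp only [Fintype.card_eq_zero, Nat.cast_zero, mul_zero] at hk
    linarith [Real.sqrt_nonneg (D : ℝ)]
  have h := (growsBelow hD hG hw hD100 hk hk' _).pow_mul_card_le (by positivity)
    (Finset.subset_univ ∅) le_rfl rfl
  have h0 : 0 < (G.acyclicFunctions α ∅).card := by
    refine Finset.card_pos.2 ⟨fun _ => Classical.arbitrary α, mem_acyclicFunctions.2 ⟨?_, ?_⟩⟩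
    · simp [ProperOn]
    · intro a c _ hc
      exact (Finset.notMem_empty _ (hc a c.start_mem_support)).elim
  have hpos := (mul_pos (pow_pos (by positivity : (0 : ℝ) < D + √(D : ℝ)) _)
    (Nat.cast_pos.2 h0)).trans_le h
  have hc : 0 < (G.acyclicFunctions α Finset.univ).card := by
    rw [Nat.pos_iff_ne_zero]
    intro h0
    rw [h0] at hpos
    simp at hpos
  obtain ⟨f, hf⟩ := Finset.card_pos.1 hc
  exact ⟨f, mem_acyclicFunctions.1 hf⟩

end Main

/-! ### From colourings to the acyclic chromatic number -/

section ChromaticNumber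

variable {V : Type*} {G : SimpleGraph V}

theorem acyclicChromaticNumber_le_of_acyclicOn_univ [Fintype V] {k : ℕ} {f : V → Fin k}
    (hf : G.AcyclicOn f Finset.univ) : G.acyclicChromaticNumber ≤ k := by
  refine Nat.sInf_le ⟨Coloring.mk f fun {a b} hab => hf.1 a (by simp) b (by simp) hab, ?_⟩
  intro i j a c hc
  have hc' := hc.map (f := (Embedding.induce _).toHom) Subtype.val_injective
  refine hf.2 _ _ hc' (fun _ _ => Finset.mem_univ _) ⟨i, j, fun x hx => ?_⟩
  rw [Walk.support_map, List.mem_map] at hx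
  obtain ⟨y, -, rfl⟩ := hx
  exact y.2

theorem acyclicChromaticNumber_le [Fintype V] [DecidableRel G.Adj] {D : ℕ} (hD : ∀ v, G.degree v ≤ D)
    (hG : G.NoCyclesThreeFourSix) (hD100 : 100 ≤ D) :
    (G.acyclicChromaticNumber : ℝ) ≤ D / lambertW 1 + 16 * √(D : ℝ) := by
  classical
  have hw0 := lambertW_one_pos
  have hw1 := one_div_lambertW_one_lt
  have hD' : (100 : ℝ) ≤ D := by exact_mod_cast hD100
  have hs10 : 10 ≤ √(D : ℝ) := Real.le_sqrt_of_sq_le (by linarith)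
  have hss := Real.sq_sqrt (Nat.cast_nonneg (α := ℝ) D)
  have hlt := (Nat.ceil_lt_add_one
    (a := (D + 8 * √(D : ℝ)) / lambertW 1) (by positivity)).le
  have hle := Nat.le_ceil ((D + 8 * √(D : ℝ)) / lambertW 1)
  generalize ⌈(D + 8 * √(D : ℝ)) / lambertW 1⌉₊ = k at hlt hle
  have h1 : (D + 8 * √(D : ℝ)) / lambertW 1 = D / lambertW 1 + 8 * √(D : ℝ) * (1 / lambertW 1) := by
    ring
  have h2 : (D : ℝ) / lambertW 1 = D * (1 / lambertW 1) := by ring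
  -- Since 8 · 1.7633 < 15, the ceiling still fits below `16 * √D`.
  have hk : (k : ℝ) ≤ D / lambertW 1 + 16 * √(D : ℝ) := by
    nlinarith
  rw [div_le_iff₀ hw0] at hle
  obtain ⟨f, hf⟩ := exists_acyclicOn_univ (α := Fin k) hD hG exp_neg_lambertW_one hD100
    (by rw [Fintype.card_fin]; linarith) (by
      rw [Fintype.card_fin]
      nlinarith)
  exact le_trans (by exact_mod_cast acyclicChromaticNumber_le_of_acyclicOn_univ hf) hk

theorem noCyclesThreeFourSix_of_le_egirth (h : 7 ≤ G.egirth) : G.NoCyclesThreeFourSix := by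
  intro a c hc
  have h7 : 7 ≤ c.length := by exact_mod_cast h.trans (egirth_le_length hc)
  omega

theorem noCyclesThreeFourSix_of_free (h : ∀ F ∈ cyclesThreeFourSix, F.2.Free G) :
    G.NoCyclesThreeFourSix := by
  intro a c hc
  have key : ∀ n, 2 < n → ⟨n, cycleGraph n⟩ ∈ cyclesThreeFourSix → c.length ≠ n :=
    fun n hn hF hl => h _ hF ((cycleGraph_isContained_iff hn).2 ⟨a, c, hc, hl⟩)
  exact ⟨key 3 (by norm_num) (by simp [cyclesThreeFourSix]),
    key 4 (by norm_num) (by simp [cyclesThreeFourSix]),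
    key 6 (by norm_num) (by simp [cyclesThreeFourSix])⟩

theorem freeAcyclicChromaticNumbers_nonempty (d : ℕ) :
    (freeAcyclicChromaticNumbers d cyclesThreeFourSix).Nonempty := by
  -- The graph without vertices contains no cycle graph, as those have vertices.
  refine ⟨_, 0, ⊥, ?_, ?_, rfl⟩
  · rintro F hF ⟨f⟩
    have hpos : Nonempty (Fin F.1) := by
      rcases hF with rfl | rfl | rfl <;> exact ⟨0⟩
    exact (f (Classical.arbitrary _)).elim0
  · exact @maxDegree_le_of_forall_degree_le _ _ _ (_) _ fun v => v.elim0

theorem le_of_mem_freeAcyclicChromaticNumbers {d k : ℕ} (hd : 100 ≤ d)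
    (hk : k ∈ freeAcyclicChromaticNumbers d cyclesThreeFourSix) :
    (k : ℝ) ≤ d / lambertW 1 + 16 * √(d : ℝ) := by
  classical
  obtain ⟨n, G, hF, hdeg, rfl⟩ := hk
  exact acyclicChromaticNumber_le (fun v => (G.degree_le_maxDegree v).trans hdeg)
    (noCyclesThreeFourSix_of_free hF) hd

end ChromaticNumber

end SimpleGraph

/-! ### Choice of constants -/

theorem mainTheorem9 :
    -- graphs of girth at least `7` (forests, of infinite girth, included)
    (∃ C : ℝ, ∀ (V : Type*) [Fintype V] (G : SimpleGraph V) [DecidableRel G.Adj],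
      7 ≤ G.egirth → 1 ≤ G.maxDegree →
        (G.acyclicChromaticNumber : ℝ) ≤ G.maxDegree / lambertW 1 + C * √(G.maxDegree : ℝ) ∧
        G.maxDegree / lambertW 1 + C * √(G.maxDegree : ℝ) <
          1.7633 * (G.maxDegree : ℝ) + C * √(G.maxDegree : ℝ)) ∧
    -- `a(d, {C₃, C₄, C₆}) < 1.7633 d` for large `d`, where `a(d, ·)` is an attained maximum
    (∀ᶠ d : ℕ in atTop,
      IsGreatest (SimpleGraph.freeAcyclicChromaticNumbers d SimpleGraph.cyclesThreeFourSix)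
          (SimpleGraph.maxFreeAcyclicChromaticNumber d SimpleGraph.cyclesThreeFourSix) ∧
        (SimpleGraph.maxFreeAcyclicChromaticNumber d SimpleGraph.cyclesThreeFourSix : ℝ) <
          1.7633 * (d : ℝ)) := by
  have hw := one_div_lambertW_one_lt
  -- For maximum degree below 100 the bound for `D = 100` is used, which is less than 177 + 160 <
  -- 350.
  refine ⟨⟨350, fun V _ G _ hgirth hdeg => ⟨?_, ?_⟩⟩, ?_⟩
  · have hG := SimpleGraph.noCyclesThreeFourSix_of_le_egirth hgirth
    have hs1 : 1 ≤ √(G.maxDegree : ℝ) := Real.one_le_sqrt.2 (by exact_mod_cast hdeg)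
    have hpos : 0 ≤ G.maxDegree / lambertW 1 :=
      div_nonneg (Nat.cast_nonneg _) lambertW_one_pos.le
    rcases le_total 100 G.maxDegree with h | h
    · have := SimpleGraph.acyclicChromaticNumber_le (fun v => G.degree_le_maxDegree v) hG h
      linarith
    · have := SimpleGraph.acyclicChromaticNumber_le (D := 100)
        (fun v => (G.degree_le_maxDegree v).trans h) hG le_rfl
      have h10 : √((100 : ℕ) : ℝ) = 10 := by
        rw [Real.sqrt_eq_iff_mul_self_eq] <;> norm_num
      have h100 : ((100 : ℕ) : ℝ) / lambertW 1 = 100 * (1 / lambertW 1) := by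
        push_cast
        ring
      rw [h10, h100] at this
      linarith
  · have h0 : (0 : ℝ) < G.maxDegree := by exact_mod_cast hdeg
    have := mul_lt_mul_of_pos_left hw h0
    rw [mul_one_div] at this
    linarith
  · have hev : ∀ᶠ d : ℕ in atTop, 16 / (1.7633 - 1 / lambertW 1) < √(d : ℝ) :=
      (Real.tendsto_sqrt_atTop.comp tendsto_natCast_atTop_atTop).eventually_gt_atTop _
    filter_upwards [hev, eventually_ge_atTop 100] with d hd h100
    have hle := fun k hk => SimpleGraph.le_of_mem_freeAcyclicChromaticNumbers (k := k) h100 hk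
    have hbdd : BddAbove
        (SimpleGraph.freeAcyclicChromaticNumbers d SimpleGraph.cyclesThreeFourSix) :=
      ⟨⌊d / lambertW 1 + 16 * √(d : ℝ)⌋₊, fun k hk => Nat.le_floor (hle k hk)⟩
    have hmem := Nat.sSup_mem (SimpleGraph.freeAcyclicChromaticNumbers_nonempty d) hbdd
    refine ⟨⟨hmem, fun k hk => le_csSup hbdd hk⟩, (hle _ hmem).trans_lt ?_⟩
    have hd0 : (0 : ℝ) < √(d : ℝ) := Real.sqrt_pos.2 (by exact_mod_cast (by omega : 0 < d))
    rw [div_lt_iff₀ (by linarith)] at hd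
    have h1 := mul_lt_mul_of_pos_right hd hd0
    have h2 : √(d : ℝ) * (1.7633 - 1 / lambertW 1) * √(d : ℝ) =
        1.7633 * d - d / lambertW 1 := by
      have := Real.mul_self_sqrt (Nat.cast_nonneg (α := ℝ) d)
      calc _ = (√(d : ℝ) * √(d : ℝ)) * (1.7633 - 1 / lambertW 1) := by ring
        _ = _ := by rw [this]; ring
    linarith
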